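/- Let $M$ be a compact 3-dimensional manifold with a (finite, simplicial) triangulation $\mathcal T$ with vertices $1,\dots,N$ and set of tetrahedra $T$. A sphere packing metric is a vector $r\in\mathbb R^N_{>0}$ such that for every $\{i,j,k,l\}\in T$ there is a nondegenerate Euclidean tetrahedron whose edge lengths are $l_{pq}=r_p+r_q$ for distinct $p,q\in\{i,j,k,l\}$. Let $$\mathfrak M_{\mathcal T}=\Big\{r\in\mathbb R^N_{>0}\ :\ \Big(\tfrac1{r_i}+\tfrac1{r_j}+\tfrac1{r_k}+\tfrac1{r_l}\Big)^2-2\Big(\tfrac1{r_i^2}+\tfrac1{r_j^2}+\tfrac1{r_k^2}+\tfrac1{r_l^2}\Big)>0\ \text{ for all }\{i,j,k,l\}\in T\Big\},$$ the space of sphere packing metrics. For $r\in\mathfrak M_{\mathcal T}$ let $K_i=4\pi-\sum_{\{i,j,k,l\}\in T}\alpha_{ijkl}$, where $\alpha_{ijkl}$ is the solid angle at the vertex $i$ of the Euclidean tetrahedron $\{i,j,k,l\}$ with edge lengths $r_p+r_q$, and the sum is over all tetrahedra containing $i$. For $\alpha\in\mathbb R$, the $\alpha$-curvature at $i$ is $R_{\alpha,i}=K_i/r_i^{\alpha}$,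 and the $\alpha$-flow is the system $$\frac{dr_i}{dt}=s_\alpha r_i^\alpha-K_i\quad(1\le i\le N),\qquad s_\alpha=\frac{\sum_{j=1}^N K_jr_j}{\sum_{j=1}^N r_j^{\alpha+1}}.$$ Let $\alpha\in\mathbb R$ and let $r:[0,b)\to\mathfrak M_{\mathcal T}$, $0<b\le\infty$, be a maximal (i.e. not extendable to a longer interval $[0,b')$) solution of the $\alpha$-flow. If there is a compact set $C\subset\mathfrak M_{\mathcal T}\cap\mathbb S^{N-1}$ (where $\mathbb S^{N-1}$ is the Euclidean unit sphere of $\mathbb R^N$) with $r(t)\in C$ for all $t\in[0,b)$, then there exists at least one sphere packing metric with constant $\alpha$-curvature on $(M,\mathcal T)$, i.e. a sphere packing metric $r^*$ such that $R_{\alpha,i}(r^*)$ is the same for all $i$. -/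

import Mathlib

noncomputable section

namespace AlphaFlow

open MeasureTheory Metric

open scoped Classical in
/-- The geometric realization of a finite abstract simplicial complex `K`: the functions
`x : V → ℝ` (barycentric coordinates) with `x ≥ 0`, `∑ x = 1` whose support is a face of `K`. -/
def realization {V : Type*} [Fintype V] (K : AbstractSimplicialComplex V) : Set (V → ℝ) :=
  {x | x ∈ stdSimplex ℝ V ∧ (Finset.univ.filter fun v => x v ≠ 0) ∈ K.faces}

/-- A triangulation, with (finite) vertex set `V`, of a topological space `M`: a simplicial complex
on `V` (all of whose vertices are used) together with a homeomorphism of its geometric realization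
onto `M`. -/
structure Triangulation (V : Type*) [Fintype V] (M : Type*) [TopologicalSpace M] where
  /-- the underlying simplicial complex -/
  complex : AbstractSimplicialComplex V
  /-- the homeomorphism of its geometric realization onto `M` -/
  homeo : realization complex ≃ₜ M

section

variable {V : Type*} [Fintype V] {M : Type*} [TopologicalSpace M]

open scoped Classical in
/-- The set of tetrahedra (3-dimensional simplices) of a triangulation. -/
def Triangulation.tetrahedra (T : Triangulation V M) : Finset (Finset V) :=
  Finset.univ.filter fun t => t ∈ T.complex.faces ∧ t.card = 4

/-- The points `p j`, `j ∈ t`, are the vertices of a (non-degenerate) Euclidean tetrahedron with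
edge lengths `l_{jk} = r_j + r_k`. -/
def IsRealizedBy (r : V → ℝ) (t : Finset V) (p : V → EuclideanSpace ℝ (Fin 3)) : Prop :=
  AffineIndependent ℝ (fun j : t => p j) ∧
    ∀ j ∈ t, ∀ k ∈ t, j ≠ k → dist (p j) (p k) = r j + r k

/-- A sphere packing metric: positive radii such that, for each tetrahedron of the triangulation,
the lengths `r_j + r_k` are the edge lengths of a Euclidean tetrahedron. -/
def IsSpherePackingMetric (T : Triangulation V M) (r : V → ℝ) : Prop :=
  (∀ i, 0 < r i) ∧ ∀ t ∈ T.tetrahedra, ∃ p, IsRealizedBy r t p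

/-- `Q_{ijkl} = (1/r_i + 1/r_j + 1/r_k + 1/r_l)² - 2 (1/r_i² + 1/r_j² + 1/r_k² + 1/r_l²)`,
for `t = {i, j, k, l}`. -/
def nondegeneracy (r : V → ℝ) (t : Finset V) : ℝ :=
  (∑ i ∈ t, 1 / r i) ^ 2 - 2 * ∑ i ∈ t, 1 / r i ^ 2

/-- The space `𝔐_𝒯` of admissible sphere packing metrics. -/
def admissibleSpace (T : Triangulation V M) : Set (V → ℝ) :=
  {r | (∀ i, 0 < r i) ∧ ∀ t ∈ T.tetrahedra, 0 < nondegeneracy r t}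

variable (V) in
/-- The Euclidean unit sphere `S^{N-1}` of `ℝ^V`, `N = |V|`. -/
def unitSphere : Set (V → ℝ) :=
  {r | ∑ i, r i ^ 2 = 1}

/-- The solid angle of a set `X` (a polyhedron) in Euclidean 3-space at the point `q`: the surface
area of the set of unit vectors pointing from `q` into `X`. -/
def solidAngleAt (X : Set (EuclideanSpace ℝ (Fin 3))) (q : EuclideanSpace ℝ (Fin 3)) : ℝ :=
  (volume : Measure (EuclideanSpace ℝ (Fin 3))).toSphere.real
    {u | ∃ c : ℝ, 0 < c ∧ q + c • (u : EuclideanSpace ℝ (Fin 3)) ∈ X}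

open scoped Classical in
/-- The solid angle at the vertex `i` of the Euclidean tetrahedron with vertices labelled by `t` and
edge lengths `r_j + r_k`. Any two realizations are congruent, so it does not matter which one is
chosen; the value is `0` if there is none. -/
def solidAngle (r : V → ℝ) (t : Finset V) (i : V) : ℝ :=
  if h : ∃ p, IsRealizedBy r t p then
    solidAngleAt (convexHull ℝ (h.choose '' (t : Set V))) (h.choose i)
  else 0

open scoped Classical in
/-- The combinatorial scalar curvature of Cooper and Rivin,
`K_i = 4π - ∑ (solid angles at i of the tetrahedra containing i)`. -/
def curvature (T : Triangulation V M) (r : V → ℝ) (i : V) : ℝ :=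
  4 * Real.pi - ∑ t ∈ T.tetrahedra with i ∈ t, solidAngle r t i

/-- The `α`-curvature `R_{α,i} = K_i / r_i^α`. -/
def alphaCurvature (T : Triangulation V M) (α : ℝ) (r : V → ℝ) (i : V) : ℝ :=
  curvature T r i / r i ^ α

/-- The functional `𝒮 = ∑ K_i r_i`. -/
def totalCurvature (T : Triangulation V M) (r : V → ℝ) : ℝ :=
  ∑ i, curvature T r i * r i

/-- `s_α = 𝒮 / ∑ r_i^(α+1)`. -/
def sAlpha (T : Triangulation V M) (α : ℝ) (r : V → ℝ) : ℝ :=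
  totalCurvature T r / ∑ i, r i ^ (α + 1)

/-- The time interval `[0, b)`, where `b` may be `∞`. -/
def timeInterval (b : EReal) : Set ℝ :=
  {s | 0 ≤ s ∧ (s : EReal) < b}

/-- `r` is a solution in `𝔐_𝒯`, on the nonempty time interval `[0, b)`, of the `α`-flow
`dr_i/dt = s_α r_i^α - K_i` (with the one-sided derivative at `t = 0`). -/
def IsAlphaFlow (T : Triangulation V M) (α : ℝ) (b : EReal) (r : ℝ → V → ℝ) : Prop :=
  0 < b ∧ ∀ s ∈ timeInterval b, r s ∈ admissibleSpace T ∧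
    ∀ i, HasDerivWithinAt (fun τ => r τ i)
      (sAlpha T α (r s) * r s i ^ α - curvature T (r s) i) (timeInterval b) s

/-- `r` is a maximal solution on `[0, b)`: it does not extend to a solution on a longer
interval `[0, b')`. -/
def IsMaximalAlphaFlow (T : Triangulation V M) (α : ℝ) (b : EReal) (r : ℝ → V → ℝ) : Prop :=
  IsAlphaFlow T α b r ∧
    ∀ b' r', b < b' → IsAlphaFlow T α b' r' → ¬ Set.EqOn r r' (timeInterval b)

end

end AlphaFlow

end

noncomputable section

namespace AlphaFlow

open MeasureTheory Metric InnerProductGeometry Filter Topology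
open scoped RealInnerProductSpace

/-! Up to a positive factor, the α-flow is a downward gradient flow. Let S = ∑ Kᵢrᵢ, and let g be a
primitive of ∑ rᵢ^α drᵢ / ∑ rᵢ^(α+1), the logarithm of a power mean (`exists_log_power_mean`). Since
dS = ∑ Kᵢ drᵢ, the functional S·exp(-g) decreases along the flow at rate exp(-g)·|dr/dt|²
(`sum_curvature_mul_flowField`). A maximal solution trapped in a compact set of metrics exists for
all time (`eq_top_of_isMaximalAlphaFlow`). If the field had no zero on that set, the rate of
decrease would be bounded below, while the functional is bounded there. So the set contains a zero
of the field, where Kᵢ = s_α rᵢ^α. Convergence of the flow is not needed.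

The geometric input is that K is C¹ and that dS = ∑ Kᵢ drᵢ, i.e. Schläfli's identity ∑ rᵢ dαᵢ = 0 in
each tetrahedron. Both come from an explicit solid angle. With κ = 1/r, σ = ∑ κ and ψⱼ = arctan((σ -
2κⱼ)/√Q), the dihedral angle at an edge is the sum of ψ over the two vertices off that edge.
Girard's formula (`volume_ball_trihedral`) then gives αᵢ = 2∑_{j≠i} ψⱼ - π (`solidAngle_eq`), which
can be differentiated directly (`hasDerivWithinAt_sum_angles`). -/

/-! ### Volumes of wedges and trihedral sectors of the unit ball. -/

lemma volume_planar_sector {φ R : ℝ} (h0 : 0 < φ) (hπ : φ < Real.pi) (hR : 0 ≤ R) :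
    volume {p : ℝ × ℝ | p.1 ^ 2 + p.2 ^ 2 < R ^ 2 ∧ 0 < p.1 ∧
      0 < Real.cos φ * p.1 + Real.sin φ * p.2} =
      ENNReal.ofReal (R ^ 2 / 2 * (Real.pi - φ)) := by
  set S := {p : ℝ × ℝ | p.1 ^ 2 + p.2 ^ 2 < R ^ 2 ∧ 0 < p.1 ∧
      0 < Real.cos φ * p.1 + Real.sin φ * p.2} with hS
  have hSm : MeasurableSet S := by
    rw [hS]
    measurability
  set P : Set (ℝ × ℝ) := Set.Ioo 0 R ×ˢ Set.Ioo (φ - Real.pi / 2) (Real.pi / 2) with hP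
  have hPm : MeasurableSet P := measurableSet_Ioo.prod measurableSet_Ioo
  have key : ∀ p ∈ polarCoord.target, (polarCoord.symm p ∈ S ↔ p ∈ P) := by
    rintro ⟨ρ, θ⟩ hp
    simp only [polarCoord_target, Set.mem_prod, Set.mem_Ioi, Set.mem_Ioo] at hp
    obtain ⟨hρ, h1, h2⟩ := hp
    simp only [hS, hP, polarCoord_symm_apply, Set.mem_ofPred_eq, Set.mem_prod, Set.mem_Ioo]
    have e1 : (ρ * Real.cos θ) ^ 2 + (ρ * Real.sin θ) ^ 2 = ρ ^ 2 := by
      linear_combination ρ ^ 2 * Real.sin_sq_add_cos_sq θ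
    have e2 : Real.cos φ * (ρ * Real.cos θ) + Real.sin φ * (ρ * Real.sin θ)
        = ρ * Real.cos (θ - φ) := by rw [Real.cos_sub]; ring
    rw [e1, e2, mul_pos_iff_of_pos_left hρ, mul_pos_iff_of_pos_left hρ]
    constructor
    · rintro ⟨a, b, c⟩
      refine ⟨⟨hρ, lt_of_pow_lt_pow_left₀ 2 hR a⟩, ?_, ?_⟩
      · by_contra! h
        have := Real.cos_nonpos_of_pi_div_two_le_of_le (x := φ - θ) (by linarith)
        rw [← Real.cos_neg, neg_sub] at this
        -- As θ ranges over (-π, π), φ - θ can pass 3π/2; then -θ exceeds π/2 and the other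
        -- half-plane condition fails.
        by_cases h3 : φ - θ ≤ Real.pi + Real.pi / 2
        · linarith [this h3]
        · have := Real.cos_nonpos_of_pi_div_two_le_of_le (x := -θ) (by linarith) (by linarith)
          rw [Real.cos_neg] at this
          linarith
      · by_contra! h
        have := Real.cos_nonpos_of_pi_div_two_le_of_le (x := θ) h (by linarith)
        linarith
    · rintro ⟨⟨_, a⟩, b, c⟩
      refine ⟨by gcongr, Real.cos_pos_of_mem_Ioo ⟨by linarith, c⟩,
        Real.cos_pos_of_mem_Ioo ⟨by linarith, by linarith⟩⟩
  have hsub : P ⊆ polarCoord.target := by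
    rintro ⟨ρ, θ⟩ ⟨⟨a, _⟩, b, c⟩
    simp only [polarCoord_target, Set.mem_prod, Set.mem_Ioi, Set.mem_Ioo] at *
    exact ⟨a, by linarith, by linarith⟩
  calc volume S = ∫⁻ p, S.indicator 1 p := (lintegral_indicator_one hSm).symm
    _ = ∫⁻ p in polarCoord.target, ENNReal.ofReal p.1 • S.indicator 1 (polarCoord.symm p) :=
      (lintegral_comp_polarCoord_symm _).symm
    _ = ∫⁻ p in polarCoord.target, P.indicator (fun p => ENNReal.ofReal p.1) p := by
      refine setLIntegral_congr_fun polarCoord.open_target.measurableSet fun p hp => ?_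
      by_cases h : p ∈ P
      · rw [Set.indicator_of_mem h, Set.indicator_of_mem ((key p hp).2 h)]
        simp
      · have : polarCoord.symm p ∉ S := fun h' => h ((key p hp).1 h')
        rw [Set.indicator_of_notMem h, Set.indicator_of_notMem this]
        simp
    _ = ∫⁻ p in P, ENNReal.ofReal p.1 := by
      rw [lintegral_indicator hPm, Measure.restrict_restrict hPm, Set.inter_eq_left.2 hsub]
    _ = ENNReal.ofReal (R ^ 2 / 2 * (Real.pi - φ)) := by
      rw [Measure.volume_eq_prod, hP, ← Measure.prod_restrict,
        lintegral_prod _ (by fun_prop)]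
      simp only [lintegral_const, Measure.restrict_apply MeasurableSet.univ, Set.univ_inter,
        Real.volume_Ioo]
      rw [lintegral_mul_const _ (by fun_prop), ← ofReal_integral_eq_lintegral_ofReal,
        ← ENNReal.ofReal_mul]
      · congr 1
        rw [← integral_Ioc_eq_integral_Ioo, ← intervalIntegral.integral_of_le hR, integral_id]
        ring
      · exact setIntegral_nonneg measurableSet_Ioo fun x hx => hx.1.le
      · exact (intervalIntegrable_iff_integrableOn_Ioo_of_le hR).1 (by simp)
      · exact (ae_restrict_iff' measurableSet_Ioo).2 (.of_forall fun x hx => hx.1.le)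

/-- Slicing perpendicular to the edge of the wedge gives planar sectors of radius √(1 - z²), and ∫
(1 - z²)/2 over (-1, 1) is 2/3. -/
lemma volume_ball_wedge_coord {φ : ℝ} (h0 : 0 < φ) (hπ : φ < Real.pi) :
    volume {x : EuclideanSpace ℝ (Fin 3) | ‖x‖ < 1 ∧ 0 < x 0 ∧
      0 < Real.cos φ * x 0 + Real.sin φ * x 1} =
      ENNReal.ofReal (2 / 3 * (Real.pi - φ)) := by
  have mp : MeasurePreserving (fun x : EuclideanSpace ℝ (Fin 3) => (x 2, (x 0, x 1))) :=
    (((MeasurePreserving.id volume).prod (volume_preserving_finTwoArrow ℝ)).comp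
      (volume_preserving_piFinSuccAbove (fun _ : Fin 3 => ℝ) 2)).comp
      (PiLp.volume_preserving_ofLp (Fin 3))
  set D : Set (ℝ × ℝ × ℝ) := {q | q.1 ^ 2 + (q.2.1 ^ 2 + q.2.2 ^ 2) < 1 ∧ 0 < q.2.1 ∧
      0 < Real.cos φ * q.2.1 + Real.sin φ * q.2.2} with hD
  have hDm : MeasurableSet D := by
    rw [hD]
    measurability
  have e : {x : EuclideanSpace ℝ (Fin 3) | ‖x‖ < 1 ∧ 0 < x 0 ∧
      0 < Real.cos φ * x 0 + Real.sin φ * x 1} =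
      (fun x : EuclideanSpace ℝ (Fin 3) => (x 2, (x 0, x 1))) ⁻¹' D := by
    ext x
    simp only [Set.mem_ofPred_eq, Set.mem_preimage, hD]
    rw [← sq_lt_one_iff₀ (norm_nonneg x), EuclideanSpace.real_norm_sq_eq, Fin.sum_univ_three,
      add_comm (x 2 ^ 2)]
  rw [e, mp.measure_preimage hDm.nullMeasurableSet, Measure.volume_eq_prod,
    Measure.prod_apply hDm]
  have sec : ∀ z : ℝ, volume (Prod.mk z ⁻¹' D) =
      (Set.Ioo (-1) 1).indicator
        (fun z => ENNReal.ofReal ((1 - z ^ 2) / 2 * (Real.pi - φ))) z := by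
    intro z
    by_cases hz : z ∈ Set.Ioo (-1 : ℝ) 1
    · have hz2 : 0 ≤ 1 - z ^ 2 := by nlinarith [hz.1, hz.2]
      rw [Set.indicator_of_mem hz]
      have := volume_planar_sector h0 hπ (Real.sqrt_nonneg (1 - z ^ 2))
      rw [Real.sq_sqrt hz2] at this
      rw [← this]
      congr 1
      ext p
      simp only [hD, Set.mem_preimage, Set.mem_ofPred_eq, lt_sub_iff_add_lt']
    · rw [Set.indicator_of_notMem hz]
      convert measure_empty (μ := (volume : Measure (ℝ × ℝ)))
      ext p
      simp only [hD, Set.mem_preimage, Set.mem_ofPred_eq, Set.mem_empty_iff_false, iff_false]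
      rintro ⟨h, -⟩
      exact hz (abs_lt.1 ((sq_lt_one_iff_abs_lt_one z).1 (by nlinarith [sq_nonneg p.1, sq_nonneg p.2])))
  simp_rw [sec]
  rw [lintegral_indicator measurableSet_Ioo, ← ofReal_integral_eq_lintegral_ofReal]
  · congr 1
    rw [← integral_Ioc_eq_integral_Ioo, ← intervalIntegral.integral_of_le (by norm_num),
      intervalIntegral.integral_mul_const, intervalIntegral.integral_div,
      intervalIntegral.integral_sub (by simp) (by simp)]
    norm_num
  · exact (intervalIntegrable_iff_integrableOn_Ioo_of_le (by norm_num)).1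
      (Continuous.intervalIntegrable (by fun_prop) _ _)
  · refine (ae_restrict_iff' measurableSet_Ioo).2 (.of_forall fun x hx => ?_)
    have : 0 ≤ 1 - x ^ 2 := by nlinarith [hx.1, hx.2]
    have : 0 ≤ Real.pi - φ := by linarith
    simp only [Pi.zero_apply]
    positivity

/-- Gram–Schmidt applied to the two normals yields an orthonormal basis in which the wedge is the
coordinate one. -/
lemma volume_ball_wedge {n₁ n₂ : EuclideanSpace ℝ (Fin 3)} (h₁ : n₁ ≠ 0) (h₂ : n₂ ≠ 0)
    (h0 : 0 < angle n₁ n₂) (hπ : angle n₁ n₂ < Real.pi) :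
    volume.real {x : EuclideanSpace ℝ (Fin 3) | ‖x‖ < 1 ∧ 0 < ⟪n₁, x⟫ ∧ 0 < ⟪n₂, x⟫} =
      2 / 3 * (Real.pi - angle n₁ n₂) := by
  set φ := angle n₁ n₂ with hφ
  have hs : 0 < Real.sin φ := Real.sin_pos_of_pos_of_lt_pi h0 hπ
  have hn₁ : 0 < ‖n₁‖ := norm_pos_iff.2 h₁
  have hn₂ : 0 < ‖n₂‖ := norm_pos_iff.2 h₂
  set f₁ : EuclideanSpace ℝ (Fin 3) := ‖n₁‖⁻¹ • n₁ with hf₁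
  set f₂ : EuclideanSpace ℝ (Fin 3) :=
    (Real.sin φ)⁻¹ • (‖n₂‖⁻¹ • n₂ - Real.cos φ • f₁) with hf₂
  have i11 : ⟪f₁, f₁⟫ = 1 := by
    rw [real_inner_self_eq_norm_sq, hf₁, norm_smul, norm_inv, norm_norm, inv_mul_cancel₀ hn₁.ne']
    norm_num
  have i1n : ⟪f₁, n₂⟫ = ‖n₂‖ * Real.cos φ := by
    rw [hf₁, real_inner_smul_left, hφ, cos_angle]
    field_simp
  have inn : ⟪n₂, n₂⟫ = ‖n₂‖ ^ 2 := real_inner_self_eq_norm_sq _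
  have i12 : ⟪f₁, f₂⟫ = 0 := by
    rw [hf₂, real_inner_smul_right, inner_sub_right, real_inner_smul_right,
      real_inner_smul_right, i11, i1n]
    field_simp
    ring
  have i22 : ⟪f₂, f₂⟫ = 1 := by
    nth_rw 1 [hf₂]
    rw [real_inner_smul_left, inner_sub_left, real_inner_smul_left, real_inner_smul_left, i12, hf₂,
      real_inner_smul_right, inner_sub_right, real_inner_smul_right, real_inner_smul_right, inn,
      real_inner_comm, i1n]
    field_simp
    rw [Real.sin_sq]
    ring
  set v : Fin 3 → EuclideanSpace ℝ (Fin 3) := ![f₁, f₂, 0] with hv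
  have hon : Orthonormal ℝ (({0, 1} : Set (Fin 3)).domRestrict v) := by
    rw [orthonormal_iff_ite]
    rintro ⟨i, hi⟩ ⟨j, hj⟩
    have i21 : ⟪f₂, f₁⟫ = 0 := by rw [real_inner_comm, i12]
    have m1 : ‖f₁‖ = 1 := by rw [norm_eq_sqrt_real_inner, i11, Real.sqrt_one]
    have m2 : ‖f₂‖ = 1 := by rw [norm_eq_sqrt_real_inner, i22, Real.sqrt_one]
    rcases hi with rfl | rfl <;> rcases hj with rfl | rfl <;>
      simp [hv, i12, i21, m1, m2, Subtype.ext_iff]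
  obtain ⟨b, hb⟩ := hon.exists_orthonormalBasis_extension_of_card_eq (by simp)
  have hb0 : b 0 = f₁ := by simpa [hv] using hb 0 (by simp)
  have hb1 : b 1 = f₂ := by simpa [hv] using hb 1 (by simp)
  have e : {x : EuclideanSpace ℝ (Fin 3) | ‖x‖ < 1 ∧ 0 < ⟪n₁, x⟫ ∧ 0 < ⟪n₂, x⟫} =
      b.repr ⁻¹' {x : EuclideanSpace ℝ (Fin 3) | ‖x‖ < 1 ∧ 0 < x 0 ∧
      0 < Real.cos φ * x 0 + Real.sin φ * x 1} := by
    ext x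
    simp only [Set.mem_ofPred_eq, Set.mem_preimage, LinearIsometryEquiv.norm_map,
      OrthonormalBasis.repr_apply_apply, hb0, hb1]
    have e1 : ⟪n₁, x⟫ = ‖n₁‖ * ⟪f₁, x⟫ := by
      rw [hf₁, real_inner_smul_left]; field_simp
    have e3 : Real.sin φ * ⟪f₂, x⟫ = ‖n₂‖⁻¹ * ⟪n₂, x⟫ - Real.cos φ * ⟪f₁, x⟫ := by
      rw [hf₂, real_inner_smul_left, inner_sub_left, real_inner_smul_left, real_inner_smul_left]
      field_simp
    have e2 : ⟪n₂, x⟫ = ‖n₂‖ * (Real.cos φ * ⟪f₁, x⟫ + Real.sin φ * ⟪f₂, x⟫) := by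
      rw [e3]
      field_simp
      ring
    rw [e1, e2, mul_pos_iff_of_pos_left hn₁, mul_pos_iff_of_pos_left hn₂]
  rw [e, measureReal_def, b.measurePreserving_repr.measure_preimage, volume_ball_wedge_coord h0 hπ,
    ENNReal.toReal_ofReal]
  · have : 0 ≤ Real.pi - φ := by linarith
    positivity
  · refine MeasurableSet.nullMeasurableSet ?_
    measurability

/-- A linearly separated pair: `angle n₁ n₂` is neither `0` nor `π`. -/
lemma angle_mem_Ioo_of_dual {n₁ n₂ e : EuclideanSpace ℝ (Fin 3)} (h1 : ⟪n₁, e⟫ ≠ 0) (h2 : ⟪n₂, e⟫ = 0) :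
    0 < angle n₂ n₁ ∧ angle n₂ n₁ < Real.pi := by
  constructor
  · refine lt_of_le_of_ne (angle_nonneg _ _) fun h => ?_
    obtain ⟨_, s, _, rfl⟩ := angle_eq_zero_iff.1 h.symm
    exact h1 (by rw [real_inner_smul_left, h2, mul_zero])
  · refine lt_of_le_of_ne (angle_le_pi _ _) fun h => ?_
    obtain ⟨_, s, _, rfl⟩ := angle_eq_pi_iff.1 h
    exact h1 (by rw [real_inner_smul_left, h2, mul_zero])

lemma ae_inner_ne_zero {n : EuclideanSpace ℝ (Fin 3)} (h : n ≠ 0) :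
    ∀ᵐ x : EuclideanSpace ℝ (Fin 3), ⟪n, x⟫ ≠ 0 := by
  have := Measure.addHaar_submodule (volume : Measure (EuclideanSpace ℝ (Fin 3)))
    (LinearMap.ker (innerSL ℝ n).toLinearMap) (fun ht => h ?_)
  · rw [ae_iff]
    convert this using 2
    ext x
    simp
  · have : n ∈ LinearMap.ker (innerSL ℝ n).toLinearMap := ht ▸ Submodule.mem_top
    simpa using this

lemma measureReal_split_sign {A : Set (EuclideanSpace ℝ (Fin 3))} {n : EuclideanSpace ℝ (Fin 3)}
    (h : n ≠ 0) (hA : volume A ≠ ⊤) :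
    volume.real A = volume.real {x | x ∈ A ∧ 0 < ⟪n, x⟫} + volume.real {x | x ∈ A ∧ ⟪n, x⟫ < 0} := by
  have hm : MeasurableSet {x : EuclideanSpace ℝ (Fin 3) | 0 < ⟪n, x⟫} :=
    measurableSet_lt (by fun_prop) (by fun_prop)
  rw [← measureReal_inter_add_sdiff (s := A) hm hA]
  congr 1
  refine measureReal_congr ?_
  filter_upwards [ae_inner_ne_zero h] with x hx
  refine propext ⟨fun ⟨a, b⟩ => ⟨a, lt_of_le_of_ne (not_lt.1 b) hx⟩, fun ⟨a, b⟩ => ⟨a, not_lt.2 b.le⟩⟩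

/-- **Girard's formula** for the volume of the trihedral sector of the unit ball. -/
lemma volume_ball_trihedral {n₁ n₂ n₃ : EuclideanSpace ℝ (Fin 3)}
    (h₁ : n₁ ≠ 0) (h₂ : n₂ ≠ 0) (h₃ : n₃ ≠ 0)
    (h12 : 0 < angle n₁ n₂ ∧ angle n₁ n₂ < Real.pi)
    (h13 : 0 < angle n₁ n₃ ∧ angle n₁ n₃ < Real.pi)
    (h23 : 0 < angle n₂ n₃ ∧ angle n₂ n₃ < Real.pi) :
    3 * volume.real {x : EuclideanSpace ℝ (Fin 3) |
        ‖x‖ < 1 ∧ 0 < ⟪n₁, x⟫ ∧ 0 < ⟪n₂, x⟫ ∧ 0 < ⟪n₃, x⟫} =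
      (Real.pi - angle n₁ n₂) + (Real.pi - angle n₁ n₃) + (Real.pi - angle n₂ n₃) - Real.pi := by
  have fin : ∀ P : EuclideanSpace ℝ (Fin 3) → Prop,
      volume {x : EuclideanSpace ℝ (Fin 3) | ‖x‖ < 1 ∧ P x} ≠ ⊤ := by
    intro P
    have hsub : {x : EuclideanSpace ℝ (Fin 3) | ‖x‖ < 1 ∧ P x} ⊆ ball 0 1 := by
      rintro x ⟨hx, -⟩
      exact mem_ball_zero_iff.2 hx
    exact ((measure_mono hsub).trans_lt measure_ball_lt_top).ne
  have neg : ∀ A B : Set (EuclideanSpace ℝ (Fin 3)), (∀ x, x ∈ A ↔ -x ∈ B) →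
      volume.real A = volume.real B := by
    intro A B h
    have : A = -B := by ext x; simp [h]
    rw [this, measureReal_def, Measure.measure_neg, measureReal_def]
  have s1 := measureReal_split_sign h₃ (fin fun x => 0 < ⟪n₁, x⟫ ∧ 0 < ⟪n₂, x⟫)
  have s2 := measureReal_split_sign h₂ (fin fun x => 0 < ⟪n₁, x⟫ ∧ 0 < ⟪n₃, x⟫)
  have s3 := measureReal_split_sign h₁ (fin fun x => 0 < ⟪n₂, x⟫ ∧ 0 < ⟪n₃, x⟫)
  -- Replacing n₂ by -n₂ gives a wedge of volume 2/3 of the angle between n₁ and n₂. Up to x ↦ -x,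
  -- its two halves are the pieces cut off in `s2` and `s3`, so `s2 + s3 - s4` isolates twice the
  -- trihedral volume.
  have s4 := measureReal_split_sign h₃ (fin fun x => 0 < ⟪n₁, x⟫ ∧ 0 < ⟪-n₂, x⟫)
  rw [volume_ball_wedge h₁ h₂ h12.1 h12.2] at s1
  rw [volume_ball_wedge h₁ h₃ h13.1 h13.2] at s2
  rw [volume_ball_wedge h₂ h₃ h23.1 h23.2] at s3
  have ha := angle_neg_right n₁ n₂
  rw [volume_ball_wedge h₁ (neg_ne_zero.2 h₂) (by linarith) (by linarith), ha] at s4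
  have q1 := neg {x : EuclideanSpace ℝ (Fin 3) |
    x ∈ {x : EuclideanSpace ℝ (Fin 3) | ‖x‖ < 1 ∧ 0 < ⟪n₁, x⟫ ∧ 0 < ⟪-n₂, x⟫} ∧ ⟪n₃, x⟫ < 0}
    {x | x ∈ {x : EuclideanSpace ℝ (Fin 3) | ‖x‖ < 1 ∧ 0 < ⟪n₂, x⟫ ∧ 0 < ⟪n₃, x⟫} ∧ ⟪n₁, x⟫ < 0}
    (fun x => by simp [inner_neg_left, inner_neg_right]; tauto)
  have q2 : {x : EuclideanSpace ℝ (Fin 3) |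
    x ∈ {x : EuclideanSpace ℝ (Fin 3) | ‖x‖ < 1 ∧ 0 < ⟪n₁, x⟫ ∧ 0 < ⟪-n₂, x⟫} ∧ 0 < ⟪n₃, x⟫} =
    {x | x ∈ {x : EuclideanSpace ℝ (Fin 3) | ‖x‖ < 1 ∧ 0 < ⟪n₁, x⟫ ∧ 0 < ⟪n₃, x⟫} ∧ ⟪n₂, x⟫ < 0} := by
    ext x; simp [inner_neg_left]; tauto
  have q3 : {x : EuclideanSpace ℝ (Fin 3) |
    x ∈ {x : EuclideanSpace ℝ (Fin 3) | ‖x‖ < 1 ∧ 0 < ⟪n₁, x⟫ ∧ 0 < ⟪n₃, x⟫} ∧ 0 < ⟪n₂, x⟫} =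
    {x | ‖x‖ < 1 ∧ 0 < ⟪n₁, x⟫ ∧ 0 < ⟪n₂, x⟫ ∧ 0 < ⟪n₃, x⟫} := by
    ext x; simp; tauto
  have q4 : {x : EuclideanSpace ℝ (Fin 3) |
    x ∈ {x : EuclideanSpace ℝ (Fin 3) | ‖x‖ < 1 ∧ 0 < ⟪n₂, x⟫ ∧ 0 < ⟪n₃, x⟫} ∧ 0 < ⟪n₁, x⟫} =
    {x | ‖x‖ < 1 ∧ 0 < ⟪n₁, x⟫ ∧ 0 < ⟪n₂, x⟫ ∧ 0 < ⟪n₃, x⟫} := by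
    ext x; simp; tauto
  rw [q1, q2] at s4
  rw [q3] at s2
  rw [q4] at s3
  linarith

/-! ### The solid angle of a simplicial cone through its dual basis. -/

section dual

variable {e n : Fin 3 → EuclideanSpace ℝ (Fin 3)}

lemma eq_sum_of_dual (hd : ∀ a b, ⟪n a, e b⟫ = if a = b then 1 else 0)
    (u : EuclideanSpace ℝ (Fin 3)) : u = ∑ a, ⟪n a, u⟫ • e a := by
  have hli : LinearIndependent ℝ e := by
    rw [Fintype.linearIndependent_iff]
    intro g hg a
    have := congrArg (fun x => ⟪n a, x⟫) hg
    simpa [inner_sum, real_inner_smul_right, hd] using this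
  have hu : u ∈ Submodule.span ℝ (Set.range e) := by
    rw [hli.span_eq_top_of_card_eq_finrank (by simp)]
    trivial
  obtain ⟨c, rfl⟩ := (Submodule.mem_span_range_iff_exists_fun ℝ).1 hu
  simp [inner_sum, real_inner_smul_right, hd]

lemma exists_add_smul_mem_convexHull_iff (hd : ∀ a b, ⟪n a, e b⟫ = if a = b then 1 else 0)
    (q u : EuclideanSpace ℝ (Fin 3)) :
    (∃ c : ℝ, 0 < c ∧ q + c • u ∈ convexHull ℝ (insert q (Set.range fun a => q + e a))) ↔
      ∀ a, 0 ≤ ⟪n a, u⟫ := by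
  constructor
  · rintro ⟨c, hc, h⟩ a
    have hsub : convexHull ℝ (insert q (Set.range fun a => q + e a)) ⊆
        {x | ⟪n a, q⟫ ≤ ⟪n a, x⟫} := by
      refine convexHull_min ?_ (convex_halfSpace_ge (innerSL ℝ (n a)).toLinearMap.isLinear _)
      rintro x (rfl | ⟨b, rfl⟩)
      · exact le_refl (⟪n a, x⟫)
      · simp only [Set.mem_ofPred_eq, inner_add_right, hd]
        split_ifs <;> simp
    have := hsub h
    simp only [Set.mem_ofPred_eq, inner_add_right, real_inner_smul_right] at this
    exact nonneg_of_mul_nonneg_right (by linarith) hc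
  · intro h
    set s := ∑ a, ⟪n a, u⟫ with hs
    have hs0 : 0 ≤ s := Finset.sum_nonneg fun a _ => h a
    have hpos : 0 < 1 + s := by linarith
    -- The weights 1 at q and ⟪n a, u⟫ at q + e a have total 1 + s; dividing by it gives a convex
    -- combination equal to q + (1 + s)⁻¹ • u.
    refine ⟨(1 + s)⁻¹, by positivity, ?_⟩
    have hq : q ∈ convexHull ℝ (insert q (Set.range fun a => q + e a)) :=
      subset_convexHull ℝ _ (Set.mem_insert _ _)
    have := (convex_convexHull ℝ (insert q (Set.range fun a => q + e a))).sum_mem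
      (t := Finset.univ) (w := fun o : Option (Fin 3) => (1 + s)⁻¹ * o.elim 1 fun a => ⟪n a, u⟫)
      (z := fun o => o.elim q fun a => q + e a) ?_ ?_ ?_
    · convert this using 1
      rw [Fintype.sum_option]
      simp only [Option.elim, smul_add, Finset.sum_add_distrib, mul_smul, ← Finset.smul_sum]
      rw [← eq_sum_of_dual hd u, ← Finset.sum_smul, ← hs, ← add_assoc, ← smul_add, one_smul]
      have : q + s • q = (1 + s) • q := by module
      rw [this, smul_smul, inv_mul_cancel₀ hpos.ne', one_smul]
    · rintro (_ | a) _
      · simp only [Option.elim]; positivity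
      · exact mul_nonneg (by positivity) (h a)
    · rw [Fintype.sum_option]
      simp only [Option.elim, ← Finset.mul_sum, ← hs]
      field_simp
    · rintro (_ | a) _
      · exact hq
      · exact subset_convexHull ℝ _ (Set.mem_insert_of_mem _ ⟨a, rfl⟩)

/-- The sphere measure is three times the volume of the cone inside the unit ball. Open and closed
half-spaces differ by null planes, so Girard's formula applies, each dihedral angle being π minus
the angle between inward normals. -/
lemma solidAngleAt_convexHull (hd : ∀ a b, ⟪n a, e b⟫ = if a = b then 1 else 0)
    (q : EuclideanSpace ℝ (Fin 3)) :
    solidAngleAt (convexHull ℝ (insert q (Set.range fun a => q + e a))) q =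
      (Real.pi - angle (n 0) (n 1)) + (Real.pi - angle (n 0) (n 2)) +
        (Real.pi - angle (n 1) (n 2)) - Real.pi := by
  have hn : ∀ a, n a ≠ 0 := fun a h => by
    have := hd a a
    simp [h] at this
  have hang : ∀ a b, a ≠ b → 0 < angle (n a) (n b) ∧ angle (n a) (n b) < Real.pi := fun a b hab =>
    angle_mem_Ioo_of_dual (e := e b) (by simp [hd]) (by simp [hd, hab])
  rw [← volume_ball_trihedral (hn 0) (hn 1) (hn 2) (hang 0 1 (by decide)) (hang 0 2 (by decide))
    (hang 1 2 (by decide)), solidAngleAt]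
  have hset : ({u : sphere (0 : EuclideanSpace ℝ (Fin 3)) 1 | ∃ c : ℝ, 0 < c ∧
      q + c • (u : EuclideanSpace ℝ (Fin 3)) ∈
        convexHull ℝ (insert q (Set.range fun a => q + e a))} :
        Set (sphere (0 : EuclideanSpace ℝ (Fin 3)) 1)) =
      {u : sphere (0 : EuclideanSpace ℝ (Fin 3)) 1 | ∀ a, 0 ≤ ⟪n a, (u : EuclideanSpace ℝ (Fin 3))⟫} := by
    ext u
    exact exists_add_smul_mem_convexHull_iff hd q _
  have hm : MeasurableSet {u : sphere (0 : EuclideanSpace ℝ (Fin 3)) 1 |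
      ∀ a, 0 ≤ ⟪n a, (u : EuclideanSpace ℝ (Fin 3))⟫} := by
    refine IsClosed.measurableSet ?_
    simp only [Set.ofPred_forall]
    exact isClosed_iInter fun a => isClosed_le (by fun_prop) (by fun_prop)
  rw [hset, measureReal_def, Measure.toSphere_apply' _ hm, ENNReal.toReal_mul, measureReal_def]
  congr 1
  · simp
  · congr 1
    refine measure_congr ?_
    filter_upwards [ae_inner_ne_zero (hn 0), ae_inner_ne_zero (hn 1), ae_inner_ne_zero (hn 2)]
      with x h0 h1 h2
    refine propext ⟨?_, ?_⟩
    · rintro ⟨c, hc, _, ⟨u, hu, rfl⟩, rfl⟩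
      have hu1 : ‖(u : EuclideanSpace ℝ (Fin 3))‖ = 1 := by simp
      have hge : ∀ a, 0 ≤ ⟪n a, c • (u : EuclideanSpace ℝ (Fin 3))⟫ := fun a => by
        rw [real_inner_smul_right]
        exact mul_nonneg hc.1.le (hu a)
      refine ⟨?_, lt_of_le_of_ne (hge 0) h0.symm, lt_of_le_of_ne (hge 1) h1.symm,
        lt_of_le_of_ne (hge 2) h2.symm⟩
      show ‖c • (u : EuclideanSpace ℝ (Fin 3))‖ < 1
      rw [norm_smul, hu1, mul_one, Real.norm_of_nonneg hc.1.le]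
      exact hc.2
    · rintro ⟨hx, p0, p1, p2⟩
      have hx0 : x ≠ 0 := by
        rintro rfl
        simp at h0
      have hnx : 0 < ‖x‖ := norm_pos_iff.2 hx0
      refine ⟨‖x‖, ⟨hnx, hx⟩, ‖x‖⁻¹ • x, ⟨⟨‖x‖⁻¹ • x, ?_⟩, ?_, rfl⟩, ?_⟩
      · simp [norm_smul, hnx.ne']
      · intro a
        simp only [real_inner_smul_right]
        refine mul_nonneg (by positivity) ?_
        fin_cases a
        exacts [p0.le, p1.le, p2.le]
      · simp [smul_smul, hnx.ne']

end dual

/-! ### Gram matrices and dihedral angles in terms of the radii. -/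

/-- The Gram matrix of the edge vectors `p a - p₀` of a tetrahedron with edge lengths `r₀ + x a`
and `x a + x b`. -/
def edgeGram (r₀ : ℝ) (x : Fin 3 → ℝ) (a b : Fin 3) : ℝ :=
  r₀ ^ 2 + r₀ * (x a + x b) - x a * x b + if a = b then 2 * x a ^ 2 else 0

/-- `Q` for the four radii `r₀, x 0, x 1, x 2`. -/
def nondeg (r₀ : ℝ) (x : Fin 3 → ℝ) : ℝ :=
  (1 / r₀ + ∑ a, 1 / x a) ^ 2 - 2 * (1 / r₀ ^ 2 + ∑ a, 1 / x a ^ 2)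

/-- The tangent of half of the contribution of the vertex `a` to the dihedral angles. -/
def cornerTan (r₀ : ℝ) (x : Fin 3 → ℝ) (a : Fin 3) : ℝ :=
  (1 / r₀ + ∑ b, 1 / x b - 2 * (1 / x a)) / √(nondeg r₀ x)

/-- The inverse of `edgeGram`. -/
def normalGram (r₀ : ℝ) (x : Fin 3 → ℝ) (a b : Fin 3) : ℝ :=
  ((if a = b then 2 else 0) - 1 + cornerTan r₀ x a * cornerTan r₀ x b) * (1 / x a * (1 / x b)) / 4

section

variable {r₀ : ℝ} {x : Fin 3 → ℝ}

lemma normalGram_comm (a b : Fin 3) : normalGram r₀ x a b = normalGram r₀ x b a := by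
  simp only [normalGram, eq_comm (a := a)]
  ring

/-- The polynomial core of the inversion of `edgeGram`: with the radii replaced by curvatures and
denominators cleared, it is checked entry by entry. -/
lemma sum_normal_mul_edge_curvature (κ : ℝ) (k : Fin 3 → ℝ) (a b : Fin 3) :
    ∑ c, (((if a = c then 2 else 0) - 1) * ((κ + ∑ b, k b) ^ 2 - 2 * (κ ^ 2 + ∑ b, k b ^ 2)) +
      (κ + ∑ b, k b - 2 * k a) * (κ + ∑ b, k b - 2 * k c)) *
      (k c * k b + κ * (k b + k c) - κ ^ 2 + if c = b then 2 * κ ^ 2 else 0) =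
    if a = b then 4 * ((κ + ∑ b, k b) ^ 2 - 2 * (κ ^ 2 + ∑ b, k b ^ 2)) * κ ^ 2 else 0 := by
  fin_cases a <;> fin_cases b <;> simp [Fin.sum_univ_three] <;> ring

lemma edgeGram_eq (hr₀ : 0 < r₀) (hx : ∀ a, 0 < x a) (a b : Fin 3) :
    edgeGram r₀ x a b = (1 / x a * (1 / x b) + 1 / r₀ * (1 / x b + 1 / x a) - (1 / r₀) ^ 2 +
      if a = b then 2 * (1 / r₀) ^ 2 else 0) / ((1 / r₀) ^ 2 * (1 / x a) * (1 / x b)) := by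
  have := (hx a).ne'
  have := (hx b).ne'
  have := hr₀.ne'
  rw [edgeGram]
  split_ifs with h
  · subst h
    field_simp
  · field_simp
    ring

lemma sum_normalGram_mul_edgeGram (hr₀ : 0 < r₀) (hx : ∀ a, 0 < x a) (hQ : 0 < nondeg r₀ x)
    (a b : Fin 3) :
    ∑ c, normalGram r₀ x a c * edgeGram r₀ x c b = if a = b then 1 else 0 := by
  have hQ' := hQ.ne'
  have hb := (hx b).ne'
  have h3 := hr₀.ne'
  have hterm : ∀ c, normalGram r₀ x a c * edgeGram r₀ x c b =
      (((if a = c then 2 else 0) - 1) * nondeg r₀ x +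
        (1 / r₀ + ∑ b, 1 / x b - 2 * (1 / x a)) * (1 / r₀ + ∑ b, 1 / x b - 2 * (1 / x c))) *
      (1 / x c * (1 / x b) + 1 / r₀ * (1 / x b + 1 / x c) - (1 / r₀) ^ 2 +
        if c = b then 2 * (1 / r₀) ^ 2 else 0) *
      (1 / x a / (4 * nondeg r₀ x * (1 / r₀) ^ 2 * (1 / x b))) := fun c => by
    have hct : cornerTan r₀ x a * cornerTan r₀ x c = (1 / r₀ + ∑ b, 1 / x b - 2 * (1 / x a)) *
        (1 / r₀ + ∑ b, 1 / x b - 2 * (1 / x c)) / nondeg r₀ x := by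
      rw [cornerTan, cornerTan, div_mul_div_comm, Real.mul_self_sqrt hQ.le]
    rw [edgeGram_eq hr₀ hx, normalGram, hct]
    have := (hx c).ne'
    generalize (1 / r₀ + ∑ b, 1 / x b - 2 * (1 / x a)) = u
    generalize (1 / r₀ + ∑ b, 1 / x b - 2 * (1 / x c)) = v
    generalize (if a = c then (2 : ℝ) else 0) = d
    generalize (if c = b then 2 * (1 / r₀) ^ 2 else 0) = d'
    field_simp
  have hQe : nondeg r₀ x =
      (1 / r₀ + ∑ a, 1 / x a) ^ 2 - 2 * ((1 / r₀) ^ 2 + ∑ a, (1 / x a) ^ 2) := by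
    simp only [nondeg, one_div, inv_pow]
  have key := sum_normal_mul_edge_curvature (1 / r₀) (fun a => 1 / x a) a b
  simp only [← hQe] at key
  rw [Finset.sum_congr rfl fun c _ => hterm c, ← Finset.sum_mul, key]
  split_ifs with h
  · subst h
    field_simp
  · simp

/-- The two numerators add up to twice the sum of the two remaining curvatures. Positivity keeps the
sum of the arctangents in (0, π), where `arccos` inverts `cos`. -/
lemma cornerTan_add_pos (hr₀ : 0 < r₀) (hx : ∀ a, 0 < x a) (hQ : 0 < nondeg r₀ x)
    {a b : Fin 3} (hab : a ≠ b) : 0 < cornerTan r₀ x a + cornerTan r₀ x b := by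
  have h0 := inv_pos.2 (hx 0)
  have h1 := inv_pos.2 (hx 1)
  have h2 := inv_pos.2 (hx 2)
  have h3 := inv_pos.2 hr₀
  rw [cornerTan, cornerTan, ← add_div]
  refine div_pos ?_ (Real.sqrt_pos.2 hQ)
  simp only [one_div, Fin.sum_univ_three]
  fin_cases a <;> fin_cases b <;> first | exact absurd rfl hab | (dsimp; linarith)

/-- The `a`-th vector of the dual family of an edge frame. -/
def normalVec (r₀ : ℝ) (x : Fin 3 → ℝ) (e : Fin 3 → EuclideanSpace ℝ (Fin 3)) (a : Fin 3) :
    EuclideanSpace ℝ (Fin 3) :=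
  ∑ c, normalGram r₀ x a c • e c

variable {e : Fin 3 → EuclideanSpace ℝ (Fin 3)}

lemma inner_normalVec_edge (hr₀ : 0 < r₀) (hx : ∀ a, 0 < x a) (hQ : 0 < nondeg r₀ x)
    (he : ∀ a b, ⟪e a, e b⟫ = edgeGram r₀ x a b) (a b : Fin 3) :
    ⟪normalVec r₀ x e a, e b⟫ = if a = b then 1 else 0 := by
  rw [normalVec, sum_inner, ← sum_normalGram_mul_edgeGram hr₀ hx hQ]
  simp [real_inner_smul_left, he]

lemma inner_normalVec_normalVec (hr₀ : 0 < r₀) (hx : ∀ a, 0 < x a) (hQ : 0 < nondeg r₀ x)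
    (he : ∀ a b, ⟪e a, e b⟫ = edgeGram r₀ x a b) (a b : Fin 3) :
    ⟪normalVec r₀ x e a, normalVec r₀ x e b⟫ = normalGram r₀ x a b := by
  nth_rw 2 [normalVec]
  simp [inner_sum, real_inner_smul_right, inner_normalVec_edge hr₀ hx hQ he, normalGram_comm b]

/-- The cosine read off from `normalGram` is (c_a c_b - 1)/√((1 + c_a²)(1 + c_b²)), which is
-cos(arctan c_a + arctan c_b). -/
lemma angle_normalVec (hr₀ : 0 < r₀) (hx : ∀ a, 0 < x a) (hQ : 0 < nondeg r₀ x)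
    (he : ∀ a b, ⟪e a, e b⟫ = edgeGram r₀ x a b) {a b : Fin 3} (hab : a ≠ b) :
    angle (normalVec r₀ x e a) (normalVec r₀ x e b) =
      Real.pi - (Real.arctan (cornerTan r₀ x a) + Real.arctan (cornerTan r₀ x b)) := by
  have hnorm : ∀ a, ‖normalVec r₀ x e a‖ = √(1 + cornerTan r₀ x a ^ 2) * (1 / x a / 2) := by
    intro a
    have := hx a
    rw [norm_eq_sqrt_real_inner, inner_normalVec_normalVec hr₀ hx hQ he, normalGram, if_pos rfl,
      ← Real.sqrt_sq (show 0 ≤ 1 / x a / 2 by positivity), ← Real.sqrt_mul (by positivity)]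
    congr 1
    ring
  have hpos := cornerTan_add_pos hr₀ hx hQ hab
  have hlt : -Real.arctan (cornerTan r₀ x b) < Real.arctan (cornerTan r₀ x a) := by
    rw [← Real.arctan_neg]
    exact Real.arctan_strictMono (by linarith)
  have h1 := Real.arctan_lt_pi_div_two (cornerTan r₀ x a)
  have h2 := Real.arctan_lt_pi_div_two (cornerTan r₀ x b)
  rw [← Real.arccos_cos (x := Real.arctan (cornerTan r₀ x a) + Real.arctan (cornerTan r₀ x b))
    (by linarith) (by linarith), ← Real.arccos_neg, angle, inner_normalVec_normalVec hr₀ hx hQ he,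
    hnorm, hnorm, normalGram, if_neg hab, Real.cos_add, Real.cos_arctan, Real.cos_arctan,
    Real.sin_arctan, Real.sin_arctan]
  congr 1
  have := (hx a).ne'
  have := (hx b).ne'
  have := (Real.sqrt_pos.2 (show 0 < 1 + cornerTan r₀ x a ^ 2 by positivity)).ne'
  have := (Real.sqrt_pos.2 (show 0 < 1 + cornerTan r₀ x b ^ 2 by positivity)).ne'
  field_simp
  ring

lemma solidAngleAt_of_edgeGram (hr₀ : 0 < r₀) (hx : ∀ a, 0 < x a) (hQ : 0 < nondeg r₀ x)
    (he : ∀ a b, ⟪e a, e b⟫ = edgeGram r₀ x a b) (q : EuclideanSpace ℝ (Fin 3)) :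
    solidAngleAt (convexHull ℝ (insert q (Set.range fun a => q + e a))) q =
      2 * ∑ a, Real.arctan (cornerTan r₀ x a) - Real.pi := by
  rw [solidAngleAt_convexHull (inner_normalVec_edge hr₀ hx hQ he),
    angle_normalVec hr₀ hx hQ he (by decide), angle_normalVec hr₀ hx hQ he (by decide),
    angle_normalVec hr₀ hx hQ he (by decide), Fin.sum_univ_three]
  ring

end

/-! ### Existence of the Euclidean tetrahedron when Q is positive. -/

/-- The form (∑ k)² - 2∑ k² is Lorentzian and, up to scale, its own dual, so a covector annihilating
a timelike vector is not timelike. The proof is Cauchy–Schwarz for the components of k and y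
orthogonal to (1, 1, 1, 1). -/
lemma sq_sum_le_two_mul_sum_sq {k y : Fin 4 → ℝ} (hky : ∑ a, k a * y a = 0)
    (hQ : 0 < (∑ a, k a) ^ 2 - 2 * ∑ a, k a ^ 2) : (∑ a, y a) ^ 2 ≤ 2 * ∑ a, y a ^ 2 := by
  have hcs := Finset.sum_mul_sq_le_sq_mul_sq Finset.univ (fun a => 4 * k a - ∑ b, k b)
    (fun a => 4 * y a - ∑ b, y b)
  have hK : 0 ≤ 4 * ∑ a, k a ^ 2 - (∑ a, k a) ^ 2 := by
    have := sq_sum_le_card_mul_sum_sq (s := Finset.univ) (f := k)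
    simp only [Finset.card_univ, Fintype.card_fin] at this
    push_cast at this
    linarith
  have hY : 0 ≤ 4 * ∑ a, y a ^ 2 - (∑ a, y a) ^ 2 := by
    have := sq_sum_le_card_mul_sum_sq (s := Finset.univ) (f := y)
    simp only [Finset.card_univ, Fintype.card_fin] at this
    push_cast at this
    linarith
  have e1 : ∑ a, (4 * k a - ∑ b, k b) * (4 * y a - ∑ b, y b) =
      -(4 * ((∑ a, k a) * ∑ a, y a)) := by
    have : ∑ a, (4 * k a - ∑ b, k b) * (4 * y a - ∑ b, y b) =
      16 * (∑ a, k a * y a) - 4 * ((∑ a, k a) * ∑ a, y a) := by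
      simp only [Fin.sum_univ_four]
      ring
    rw [this, hky]
    ring
  have e2 : ∀ z : Fin 4 → ℝ, ∑ a, (4 * z a - ∑ b, z b) ^ 2 =
      4 * (4 * ∑ a, z a ^ 2 - (∑ a, z a) ^ 2) := fun z => by
    simp only [Fin.sum_univ_four]
    ring
  rw [e1, e2, e2] at hcs
  by_contra! h
  nlinarith [mul_le_mul_of_nonneg_left (show 4 * ∑ a, y a ^ 2 - (∑ a, y a) ^ 2 ≤ (∑ a, y a) ^ 2 by
    linarith) hK]

/-- Substituting y = (-r₀ ∑ z, x a · z a) turns 2∑ y² - (∑ y)² into the Gram form, and this y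
annihilates the curvature vector. -/
lemma edgeGram_quadratic_nonneg {r₀ : ℝ} {x : Fin 3 → ℝ} (hr₀ : 0 < r₀) (hx : ∀ a, 0 < x a)
    (hQ : 0 < nondeg r₀ x) (z : Fin 3 → ℝ) :
    0 ≤ ∑ a, ∑ b, z a * edgeGram r₀ x a b * z b := by
  have h := sq_sum_le_two_mul_sum_sq
    (k := Fin.cons (1 / r₀) fun a => 1 / x a)
    (y := Fin.cons (-(r₀ * ∑ a, z a)) fun a => x a * z a) ?_ ?_
  · simp only [Fin.sum_univ_succ (n := 3), Fin.cons_zero, Fin.cons_succ] at h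
    simp only [edgeGram, Fin.sum_univ_three] at h ⊢
    simp only [reduceIte, Fin.reduceEq]
    linarith
  · rw [Fin.sum_univ_succ]
    simp only [Fin.cons_zero, Fin.cons_succ, ← mul_assoc, one_div, inv_mul_cancel₀ (hx _).ne',
      one_mul]
    field_simp
    ring
  · simpa only [Fin.sum_univ_succ (n := 3), Fin.cons_zero, Fin.cons_succ, one_div, inv_pow, nondeg] using hQ

-- The columns of a factor B in `star B * B` serve as edge vectors. Semidefiniteness suffices:
-- linear independence follows from the dual family `normalVec`.
open scoped MatrixOrder in
lemma exists_edge_frame {r₀ : ℝ} {x : Fin 3 → ℝ} (hr₀ : 0 < r₀) (hx : ∀ a, 0 < x a)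
    (hQ : 0 < nondeg r₀ x) :
    ∃ e : Fin 3 → EuclideanSpace ℝ (Fin 3), ∀ a b, ⟪e a, e b⟫ = edgeGram r₀ x a b := by
  have hpsd : (Matrix.of (edgeGram r₀ x)).PosSemidef := by
    refine Matrix.PosSemidef.of_dotProduct_mulVec_nonneg ?_ fun z => ?_
    · ext a b
      rcases eq_or_ne a b with rfl | h
      · simp
      · simp only [Matrix.conjTranspose_apply, Matrix.of_apply, edgeGram, if_neg h, if_neg h.symm,
          star_trivial]
        ring
    · refine (edgeGram_quadratic_nonneg hr₀ hx hQ z).trans_eq ?_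
      simp only [dotProduct, Matrix.mulVec, Matrix.of_apply, Finset.mul_sum, star_trivial, mul_assoc]
  obtain ⟨B, hB⟩ := CStarAlgebra.nonneg_iff_eq_star_mul_self.1 hpsd.nonneg
  refine ⟨fun a => WithLp.toLp 2 fun c => B c a, fun a b => ?_⟩
  have := congrFun (congrFun hB a) b
  rw [Matrix.of_apply] at this
  rw [this]
  simp [Matrix.mul_apply, PiLp.inner_apply, mul_comm]

/-! ### Realizations and solid angles for tetrahedra labelled by a finset. -/

section labelled

variable {V : Type*} {t : Finset V} {i : V} {r : V → ℝ}

lemma exists_labelling (ht : t.card = 4) (hi : i ∈ t) :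
    ∃ v : Fin 3 → V, v.Injective ∧ (∀ a, v a ≠ i) ∧ (∀ u, u ∈ t ↔ u = i ∨ ∃ a, v a = u) ∧
      (∀ g : V → ℝ, ∑ j ∈ t, g j = g i + ∑ a, g (v a)) ∧
      ∀ g : V → ℝ, ∏ j ∈ t, g j = g i * ∏ a, g (v a) := by
  classical
  have hc : (t.erase i).card = 3 := by rw [Finset.card_erase_of_mem hi, ht]
  set f := Finset.equivFinOfCardEq hc with hf
  have hmem : ∀ a, (f.symm a : V) ∈ t.erase i := fun a => (f.symm a).2
  refine ⟨fun a => f.symm a, Subtype.val_injective.comp f.symm.injective,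
    fun a => Finset.ne_of_mem_erase (hmem a), fun u => ⟨fun hu => ?_, ?_⟩, fun g => ?_, fun g => ?_⟩
  · by_cases h : u = i
    · exact Or.inl h
    · exact Or.inr ⟨f ⟨u, Finset.mem_erase.2 ⟨h, hu⟩⟩, by simp⟩
  · rintro (rfl | ⟨a, rfl⟩)
    exacts [hi, Finset.mem_of_mem_erase (hmem a)]
  · rw [← Finset.add_sum_erase t g hi, ← Finset.sum_coe_sort (t.erase i) g]
    congr 1
    exact (f.symm.sum_comp fun u => g u).symm
  · rw [← Finset.mul_prod_erase t g hi, ← Finset.prod_coe_sort (t.erase i) g]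
    congr 1
    exact (f.symm.prod_comp fun u => g u).symm

lemma nondegeneracy_eq_nondeg {v : Fin 3 → V}
    (hs : ∀ g : V → ℝ, ∑ j ∈ t, g j = g i + ∑ a, g (v a)) :
    nondegeneracy r t = nondeg (r i) (fun a => r (v a)) := by
  rw [nondegeneracy, nondeg, hs, hs]

/-- The tangent of half of the contribution of the vertex `j` to the dihedral angles of the
tetrahedron `t`. -/
def vertexTan (r : V → ℝ) (t : Finset V) (j : V) : ℝ :=
  (∑ k ∈ t, 1 / r k - 2 * (1 / r j)) / √(nondegeneracy r t)

/-- A tetrahedron with positive `Q` is realized by a Euclidean tetrahedron. -/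
theorem exists_isRealizedBy (hr : ∀ j, 0 < r j) (ht : t.card = 4) (hQ : 0 < nondegeneracy r t) :
    ∃ p, IsRealizedBy r t p := by
  obtain ⟨i, hi⟩ : t.Nonempty := Finset.card_pos.1 (by omega)
  obtain ⟨v, hv, hvi, hmem, hs, -⟩ := exists_labelling ht hi
  rw [nondegeneracy_eq_nondeg hs] at hQ
  obtain ⟨e, he⟩ := exists_edge_frame (hr i) (fun a => hr (v a)) hQ
  have hd := inner_normalVec_edge (hr i) (fun a => hr (v a)) hQ he
  have hli : LinearIndependent ℝ e := by
    rw [Fintype.linearIndependent_iff]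
    intro g hg a
    have := congrArg (fun x => ⟪normalVec (r i) (fun a => r (v a)) e a, x⟫) hg
    simpa [inner_sum, real_inner_smul_right, hd] using this
  set p : V → EuclideanSpace ℝ (Fin 3) := Function.extend v e 0 with hp
  have hpv : ∀ a, p (v a) = e a := fun a => hv.extend_apply _ _ _
  have hpi : p i = 0 := Function.extend_apply' _ _ _ fun ⟨a, ha⟩ => hvi a ha
  have hnorm : ∀ a, ‖e a‖ = r i + r (v a) := fun a => by
    have h1 := hr i
    have h2 := hr (v a)
    rw [norm_eq_sqrt_real_inner, he, edgeGram, if_pos rfl,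
      Real.sqrt_eq_iff_mul_self_eq_of_pos (by positivity)]
    ring
  refine ⟨p, ?_, fun j hj k hk hjk => ?_⟩
  · rw [affineIndependent_iff_linearIndependent_vsub ℝ _ (⟨i, hi⟩ : t)]
    have hlab : ∀ x : {x : t // x ≠ ⟨i, hi⟩}, ∃ a, v a = x.1.1 := fun x =>
      ((hmem _).1 x.1.2).resolve_left fun h => x.2 (Subtype.ext h)
    choose f hf using hlab
    have hfi : f.Injective := fun x y hxy =>
      Subtype.ext (Subtype.ext (by rw [← hf x, ← hf y, hxy]))
    have hcomp : (fun x : {x : t // x ≠ ⟨i, hi⟩} => p x -ᵥ p i) = e ∘ f := by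
      ext1 x
      simp only [vsub_eq_sub, Function.comp, hpi, sub_zero, ← hpv, hf]
    rw [hcomp]
    exact hli.comp f hfi
  · rcases (hmem j).1 hj with rfl | ⟨a, rfl⟩ <;> rcases (hmem k).1 hk with rfl | ⟨b, rfl⟩
    · exact absurd rfl hjk
    · rw [hpi, hpv, dist_zero_left, hnorm]
    · rw [hpi, hpv, dist_zero_right, hnorm, add_comm]
    · have hab : a ≠ b := fun h => hjk (congrArg v h)
      have h1 := hr (v a)
      have h2 := hr (v b)
      rw [hpv, hpv, dist_eq_norm, ← sq_eq_sq₀ (norm_nonneg _) (by positivity), norm_sub_sq_real,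
        hnorm, hnorm, he, edgeGram, if_neg hab]
      ring

/-- The solid angle of a realization in terms of the radii. -/
theorem solidAngleAt_of_isRealizedBy (hr : ∀ j, 0 < r j) (ht : t.card = 4)
    (hQ : 0 < nondegeneracy r t) (hi : i ∈ t) {p : V → EuclideanSpace ℝ (Fin 3)}
    (hp : IsRealizedBy r t p) :
    solidAngleAt (convexHull ℝ (p '' (t : Set V))) (p i) =
      2 * (∑ j ∈ t, Real.arctan (vertexTan r t j) - Real.arctan (vertexTan r t i)) - Real.pi := by
  obtain ⟨v, hv, hvi, hmem, hs, -⟩ := exists_labelling ht hi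
  have hvt : ∀ a, v a ∈ t := fun a => (hmem _).2 (Or.inr ⟨a, rfl⟩)
  have hQ' := hQ
  rw [nondegeneracy_eq_nondeg hs] at hQ'
  have hnorm : ∀ a, ‖p (v a) - p i‖ = r i + r (v a) := fun a => by
    rw [← dist_eq_norm, hp.2 _ (hvt a) _ hi (hvi a), add_comm]
  have he : ∀ a b, ⟪p (v a) - p i, p (v b) - p i⟫ = edgeGram (r i) (fun a => r (v a)) a b := by
    intro a b
    rcases eq_or_ne a b with rfl | hab
    · rw [real_inner_self_eq_norm_sq, hnorm, edgeGram, if_pos rfl]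
      ring
    · have h1 : ‖(p (v a) - p i) - (p (v b) - p i)‖ = r (v a) + r (v b) := by
        rw [sub_sub_sub_cancel_right, ← dist_eq_norm, hp.2 _ (hvt a) _ (hvt b) (hv.ne hab)]
      have h2 := norm_sub_sq_real (p (v a) - p i) (p (v b) - p i)
      rw [h1, hnorm, hnorm] at h2
      rw [edgeGram, if_neg hab]
      linarith
  have himg : p '' (t : Set V) =
      insert (p i) (Set.range fun a => p i + (p (v a) - p i)) := by
    ext y
    simp only [Set.mem_image, Finset.mem_coe, hmem, Set.mem_insert_iff, Set.mem_range,
      add_sub_cancel]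
    constructor
    · rintro ⟨u, rfl | ⟨a, rfl⟩, rfl⟩
      exacts [Or.inl rfl, Or.inr ⟨a, rfl⟩]
    · rintro (rfl | ⟨a, rfl⟩)
      exacts [⟨i, Or.inl rfl, rfl⟩, ⟨v a, Or.inr ⟨a, rfl⟩, rfl⟩]
  rw [himg, solidAngleAt_of_edgeGram (hr i) (fun a => hr (v a)) hQ' he, hs]
  simp only [vertexTan, cornerTan, nondegeneracy_eq_nondeg hs, hs fun k => 1 / r k]
  ring

theorem solidAngle_eq (hr : ∀ j, 0 < r j) (ht : t.card = 4)
    (hQ : 0 < nondegeneracy r t) (hi : i ∈ t) :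
    solidAngle r t i =
      2 * (∑ j ∈ t, Real.arctan (vertexTan r t j) - Real.arctan (vertexTan r t i)) - Real.pi := by
  have h := exists_isRealizedBy hr ht hQ
  rw [solidAngle, dif_pos h]
  exact solidAngleAt_of_isRealizedBy hr ht hQ hi h.choose_spec

end labelled

/-! ### Schläfli's identity for a single tetrahedron. -/

section schlaefli

variable {V : Type*} {t : Finset V}

/-- The factor Q + (σ - 2κᵢ)² is the denominator in the derivative of ψᵢ; this identity trades it
for the weight ∑_{j≠i} rⱼ and a product symmetric in the vertices. -/
lemma sum_sub_mul_prod_curvature {r : V → ℝ} (hr : ∀ j, 0 < r j) (ht : t.card = 4) {i : V}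
    (hi : i ∈ t) :
    (∑ j ∈ t, r j - r i) * (4 * ∏ j ∈ t, 1 / r j) =
      1 / r i * (nondegeneracy r t + (∑ k ∈ t, 1 / r k - 2 * (1 / r i)) ^ 2) := by
  obtain ⟨v, -, -, -, hs, hp⟩ := exists_labelling ht hi
  simp only [nondegeneracy, hs, hp, Fin.sum_univ_three, Fin.prod_univ_three]
  have := (hr i).ne'
  have := (hr (v 0)).ne'
  have := (hr (v 1)).ne'
  have := (hr (v 2)).ne'
  field_simp
  ring

variable {s : Set ℝ} {τ : ℝ} {r : ℝ → V → ℝ} {r' : V → ℝ}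

/-- By the product rule the claim is ∑ rᵢ dαᵢ = 0. Regrouped as 2∑ᵢ (∑_{j≠i} rⱼ) dψᵢ, the sum loses
its denominators and is proportional to 2Q(σσ' - 2∑ κκ') - (σ² - 2∑ κ²)Q' = QQ' - QQ' = 0. -/
lemma hasDerivWithinAt_sum_angles (hr : ∀ j, 0 < r τ j) (ht : t.card = 4)
    (hQ : 0 < nondegeneracy (r τ) t) (hd : ∀ j, HasDerivWithinAt (fun τ => r τ j) (r' j) s τ) :
    HasDerivWithinAt (fun τ => ∑ i ∈ t, (2 * (∑ j ∈ t, Real.arctan (vertexTan (r τ) t j) -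
        Real.arctan (vertexTan (r τ) t i)) - Real.pi) * r τ i)
      (∑ i ∈ t, (2 * (∑ j ∈ t, Real.arctan (vertexTan (r τ) t j) -
        Real.arctan (vertexTan (r τ) t i)) - Real.pi) * r' i) s τ := by
  set k' : V → ℝ := fun j => -r' j / r τ j ^ 2 with hk'
  have hk : ∀ j, HasDerivWithinAt (fun τ => 1 / r τ j) (k' j) s τ := fun j => by
    simpa only [one_div] using (hd j).fun_inv (hr j).ne'
  have hσ : HasDerivWithinAt (fun τ => ∑ j ∈ t, 1 / r τ j) (∑ j ∈ t, k' j) s τ :=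
    HasDerivWithinAt.fun_sum fun j _ => hk j
  set Q := nondegeneracy (r τ) t with hQdef
  set σ := ∑ j ∈ t, 1 / r τ j with hσdef
  set Q' := 2 * σ * (∑ j ∈ t, k' j) - 4 * ∑ j ∈ t, 1 / r τ j * k' j with hQ'
  have hQd : HasDerivWithinAt (fun τ => nondegeneracy (r τ) t) Q' s τ := by
    have h1 := (hσ.fun_pow 2).sub
      ((HasDerivWithinAt.fun_sum (u := t) fun j _ => (hk j).fun_pow 2).const_mul 2)
    convert! h1 using 1
    · ext τ
      simp [nondegeneracy]
    · have : ∑ j ∈ t, ((2 : ℕ) : ℝ) * (1 / r τ j) ^ (2 - 1) * k' j =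
          2 * ∑ j ∈ t, 1 / r τ j * k' j := by
        rw [Finset.mul_sum]
        exact Finset.sum_congr rfl fun j _ => by norm_num; ring
      rw [hQ', this, ← hσdef]
      norm_num
      ring
  set ψ' : V → ℝ := fun i => (2 * Q * (∑ j ∈ t, k' j - 2 * k' i) - (σ - 2 * (1 / r τ i)) * Q') /
    (2 * √Q * (Q + (σ - 2 * (1 / r τ i)) ^ 2)) with hψ'
  have hsq : 0 < √Q := Real.sqrt_pos.2 hQ
  have hψ : ∀ i, HasDerivWithinAt (fun τ => Real.arctan (vertexTan (r τ) t i)) (ψ' i) s τ := by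
    intro i
    have h1 := ((hσ.fun_sub ((hk i).const_mul 2)).fun_div (hQd.sqrt hQ.ne') hsq.ne').arctan
    refine h1.congr_deriv ?_
    simp only [hψ', ← hσdef, ← hQdef]
    have hpos : 0 < Q + (σ - 2 * (1 / r τ i)) ^ 2 := by positivity
    generalize (σ - 2 * (1 / r τ i)) = h at *
    have e : Q = √Q ^ 2 := (Real.sq_sqrt hQ.le).symm
    generalize √Q = w at *
    rw [e] at hpos ⊢
    field_simp
  have hΨ : HasDerivWithinAt (fun τ => ∑ j ∈ t, Real.arctan (vertexTan (r τ) t j))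
      (∑ j ∈ t, ψ' j) s τ := HasDerivWithinAt.fun_sum fun j _ => hψ j
  have hmain := HasDerivWithinAt.fun_sum (u := t) fun i _ =>
    (((hΨ.fun_sub (hψ i)).const_mul 2).sub_const Real.pi).fun_mul (hd i)
  refine hmain.congr_deriv ?_
  rw [Finset.sum_add_distrib, add_eq_right]
  have hP : 0 < 4 * ∏ j ∈ t, 1 / r τ j := by
    have := Finset.prod_pos (s := t) fun j _ => one_div_pos.2 (hr j)
    positivity
  have e1 : ∑ i ∈ t, 2 * (∑ j ∈ t, ψ' j - ψ' i) * r τ i =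
      2 * ∑ i ∈ t, (∑ j ∈ t, r τ j - r τ i) * ψ' i := by
    simp only [sub_mul, mul_sub, Finset.sum_sub_distrib, ← Finset.mul_sum, mul_assoc]
    congr 2
    · ring
    · exact Finset.sum_congr rfl fun i _ => mul_comm _ _
  have e2 : ∀ i ∈ t, (∑ j ∈ t, r τ j - r τ i) * ψ' i = 1 / (2 * √Q * (4 * ∏ j ∈ t, 1 / r τ j)) *
      (2 * Q * (1 / r τ i * ∑ j ∈ t, k' j - 2 * (1 / r τ i * k' i)) -
        (1 / r τ i * σ - 2 * (1 / r τ i) ^ 2) * Q') := fun i hi => by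
    have h := sum_sub_mul_prod_curvature hr ht hi
    rw [← hσdef, ← hQdef] at h
    have hpos : 0 < Q + (σ - 2 * (1 / r τ i)) ^ 2 := by positivity
    rw [eq_div_of_mul_eq hP.ne' h, hψ']
    dsimp only
    generalize (4 * ∏ j ∈ t, 1 / r τ j) = P at *
    generalize 1 / r τ i = κ at *
    field_simp
  have e3 : ∑ i ∈ t, (1 / r τ i) ^ 2 = (σ ^ 2 - Q) / 2 := by
    rw [hQdef, nondegeneracy, ← hσdef]
    simp only [one_div, inv_pow]
    ring
  have e4 : ∑ i ∈ t, 1 / r τ i * k' i = (2 * σ * (∑ j ∈ t, k' j) - Q') / 4 := by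
    rw [hQ']
    ring
  rw [e1, Finset.sum_congr rfl e2, ← Finset.mul_sum, Finset.sum_sub_distrib, ← Finset.mul_sum,
    ← Finset.sum_mul, Finset.sum_sub_distrib, Finset.sum_sub_distrib, ← Finset.mul_sum,
    ← Finset.mul_sum, ← Finset.sum_mul, ← Finset.sum_mul, ← hσdef, e3, e4]
  ring

end schlaefli

/-! ### Regularity of the curvature and of the flow field. -/

section field

variable {V : Type*} [Fintype V] {M : Type*} [TopologicalSpace M] {T : Triangulation V M}

lemma Triangulation.card_of_mem_tetrahedra {t : Finset V} (ht : t ∈ T.tetrahedra) :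
    t.card = 4 := by
  simp only [Triangulation.tetrahedra, Finset.mem_filter] at ht
  exact ht.2.2

lemma isSpherePackingMetric_of_mem_admissibleSpace {r : V → ℝ} (hr : r ∈ admissibleSpace T) :
    IsSpherePackingMetric T r :=
  ⟨hr.1, fun t ht => exists_isRealizedBy hr.1 (T.card_of_mem_tetrahedra ht) (hr.2 t ht)⟩

open scoped Classical in
lemma curvature_eq {r : V → ℝ} (hr : r ∈ admissibleSpace T) (i : V) :
    curvature T r i = 4 * Real.pi - ∑ t ∈ T.tetrahedra with i ∈ t,
      (2 * (∑ j ∈ t, Real.arctan (vertexTan r t j) - Real.arctan (vertexTan r t i)) - Real.pi) := by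
  rw [curvature]
  congr 1
  refine Finset.sum_congr rfl fun t ht => ?_
  obtain ⟨ht, hi⟩ := Finset.mem_filter.1 ht
  exact solidAngle_eq hr.1 (T.card_of_mem_tetrahedra ht) (hr.2 t ht) hi

/-- Exchanging the sums over vertices and tetrahedra reduces the variational formula to single
tetrahedra. The vector y stays free, to be either the radii or their derivatives. -/
lemma sum_curvature_mul {r : V → ℝ} (hr : r ∈ admissibleSpace T) (y : V → ℝ) :
    ∑ i, curvature T r i * y i = ∑ i, 4 * Real.pi * y i - ∑ t ∈ T.tetrahedra, ∑ i ∈ t,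
      (2 * (∑ j ∈ t, Real.arctan (vertexTan r t j) - Real.arctan (vertexTan r t i)) - Real.pi)
        * y i := by
  classical
  have h : ∀ i, curvature T r i * y i = 4 * Real.pi * y i - ∑ t ∈ T.tetrahedra with i ∈ t,
      (2 * (∑ j ∈ t, Real.arctan (vertexTan r t j) - Real.arctan (vertexTan r t i)) - Real.pi)
        * y i := fun i => by rw [curvature_eq hr, sub_mul, Finset.sum_mul]
  rw [Finset.sum_congr rfl fun i _ => h i, Finset.sum_sub_distrib]
  congr 1
  exact Finset.sum_comm' fun i t => by simp [and_comm]

/-- The variational formula `d(∑ Kᵢ rᵢ) = ∑ Kᵢ drᵢ`. -/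
theorem hasDerivWithinAt_totalCurvature {s : Set ℝ} {τ : ℝ} {r : ℝ → V → ℝ} {r' : V → ℝ}
    (hr : ∀ τ ∈ s, r τ ∈ admissibleSpace T) (hτ : τ ∈ s)
    (hd : ∀ j, HasDerivWithinAt (fun τ => r τ j) (r' j) s τ) :
    HasDerivWithinAt (fun τ => totalCurvature T (r τ)) (∑ i, curvature T (r τ) i * r' i) s τ := by
  rw [sum_curvature_mul (hr τ hτ)]
  refine HasDerivWithinAt.congr (f := fun τ => ∑ i, 4 * Real.pi * r τ i -
    ∑ t ∈ T.tetrahedra, ∑ i ∈ t, (2 * (∑ j ∈ t, Real.arctan (vertexTan (r τ) t j) -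
      Real.arctan (vertexTan (r τ) t i)) - Real.pi) * r τ i) ?_
    (fun τ hτ => sum_curvature_mul (hr τ hτ) _) (sum_curvature_mul (hr τ hτ) _)
  refine HasDerivWithinAt.fun_sub (HasDerivWithinAt.fun_sum fun i _ => (hd i).const_mul _)
    (HasDerivWithinAt.fun_sum fun t ht => ?_)
  exact hasDerivWithinAt_sum_angles (hr τ hτ).1 (T.card_of_mem_tetrahedra ht) ((hr τ hτ).2 t ht) hd

lemma contDiffAt_nondegeneracy {r : V → ℝ} (hr : ∀ i, 0 < r i) (t : Finset V) :
    ContDiffAt ℝ 1 (fun r : V → ℝ => nondegeneracy r t) r := by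
  have h : ∀ i, ContDiffAt ℝ 1 (fun r : V → ℝ => r i) r := fun i =>
    (contDiff_apply ℝ ℝ i).contDiffAt
  unfold nondegeneracy
  refine ((ContDiffAt.sum fun i _ => contDiffAt_const.div (h i) (hr i).ne').pow 2).sub
    (contDiffAt_const.mul (ContDiffAt.sum fun i _ => contDiffAt_const.div ((h i).pow 2) ?_))
  exact pow_ne_zero 2 (hr i).ne'

lemma admissibleSpace_mem_nhds {r : V → ℝ} (hr : r ∈ admissibleSpace T) :
    admissibleSpace T ∈ 𝓝 r := by
  have h1 : ∀ᶠ x in 𝓝 r, ∀ i, 0 < x i :=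
    eventually_all.2 fun i => (continuous_apply i).continuousAt.eventually (lt_mem_nhds (hr.1 i))
  have h2 : ∀ᶠ x in 𝓝 r, ∀ t ∈ T.tetrahedra, 0 < nondegeneracy x t :=
    (Finset.eventually_all _).2 fun t ht =>
      (contDiffAt_nondegeneracy hr.1 t).continuousAt.eventually (lt_mem_nhds (hr.2 t ht))
  exact h1.and h2

/-- Since `solidAngle` depends on a chosen realization, regularity is read off from the arctangent
formula, which holds on a whole neighbourhood because admissibility is open. -/
lemma contDiffAt_curvature {r : V → ℝ} (hr : r ∈ admissibleSpace T) (i : V) :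
    ContDiffAt ℝ 1 (fun r => curvature T r i) r := by
  classical
  have h : ∀ i, ContDiffAt ℝ 1 (fun r : V → ℝ => r i) r := fun i =>
    (contDiff_apply ℝ ℝ i).contDiffAt
  have hinv : ∀ i, ContDiffAt ℝ 1 (fun r : V → ℝ => 1 / r i) r := fun i =>
    contDiffAt_const.div (h i) (hr.1 i).ne'
  have hψ : ∀ t ∈ T.tetrahedra, ∀ j,
      ContDiffAt ℝ 1 (fun r => Real.arctan (vertexTan r t j)) r := fun t ht j =>
    (((ContDiffAt.sum fun i _ => hinv i).sub (contDiffAt_const.mul (hinv j))).div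
      ((contDiffAt_nondegeneracy hr.1 t).sqrt (hr.2 t ht).ne')
      (Real.sqrt_pos.2 (hr.2 t ht)).ne').arctan
  have hform : ContDiffAt ℝ 1 (fun r : V → ℝ => 4 * Real.pi - ∑ t ∈ T.tetrahedra with i ∈ t,
      (2 * (∑ j ∈ t, Real.arctan (vertexTan r t j) - Real.arctan (vertexTan r t i)) - Real.pi)) r :=
    contDiffAt_const.sub (ContDiffAt.sum fun t ht =>
      (contDiffAt_const.mul ((ContDiffAt.sum fun j _ => hψ t (Finset.mem_filter.1 ht).1 j).sub
        (hψ t (Finset.mem_filter.1 ht).1 i))).sub contDiffAt_const)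
  refine hform.congr_of_eventuallyEq ?_
  filter_upwards [admissibleSpace_mem_nhds hr] with x hx
  exact curvature_eq hx i

lemma contDiffAt_totalCurvature {r : V → ℝ} (hr : r ∈ admissibleSpace T) :
    ContDiffAt ℝ 1 (totalCurvature T) r :=
  ContDiffAt.sum fun i _ => (contDiffAt_curvature hr i).mul (contDiff_apply ℝ ℝ i).contDiffAt

/-- The vector field of the `α`-flow. -/
def flowField (T : Triangulation V M) (α : ℝ) (r : V → ℝ) (i : V) : ℝ :=
  sAlpha T α r * r i ^ α - curvature T r i

lemma contDiffAt_flowField [Nonempty V] (α : ℝ) {r : V → ℝ} (hr : r ∈ admissibleSpace T) :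
    ContDiffAt ℝ 1 (flowField T α) r := by
  have hpow : ∀ (β : ℝ) (i : V), ContDiffAt ℝ 1 (fun r : V → ℝ => r i ^ β) r := fun β i =>
    (contDiff_apply ℝ ℝ i).contDiffAt.rpow_const_of_ne (hr.1 i).ne'
  have hL : 0 < ∑ i, r i ^ (α + 1) :=
    Finset.sum_pos (fun i _ => Real.rpow_pos_of_pos (hr.1 i) _) Finset.univ_nonempty
  refine contDiffAt_pi.2 fun i => ?_
  exact (((contDiffAt_totalCurvature hr).div (ContDiffAt.sum fun i _ => hpow _ i) hL.ne').mul
    (hpow α i)).sub (contDiffAt_curvature hr i)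

end field

/-! ### Extension of trapped solutions and global existence. -/

/-- A solution on `[0, b)` of an autonomous `C¹` system that stays in a compact subset of the
domain extends beyond `b`. -/
theorem exists_extension_of_mem_compact {V : Type*} [Fintype V] {F : (V → ℝ) → V → ℝ}
    {U C : Set (V → ℝ)} (hU : IsOpen U) (hF : ∀ x ∈ U, ContDiffAt ℝ 1 F x) (hC : IsCompact C)
    (hCU : C ⊆ U) {b : ℝ} (hb : 0 < b) {r : ℝ → V → ℝ}
    (hr : ∀ s ∈ Set.Ico 0 b, HasDerivWithinAt r (F (r s)) (Set.Ico 0 b) s)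
    (hrC : ∀ s ∈ Set.Ico 0 b, r s ∈ C) :
    ∃ b' > b, ∃ r' : ℝ → V → ℝ, Set.EqOn r r' (Set.Ico 0 b) ∧ ∀ s ∈ Set.Ico 0 b',
      r' s ∈ U ∧ HasDerivWithinAt r' (F (r' s)) (Set.Ico 0 b') s := by
  have hFC : ContinuousOn F C := fun x hx => (hF x (hCU hx)).continuousAt.continuousWithinAt
  obtain ⟨K, hK⟩ := hC.exists_bound_of_continuousOn hFC
  -- The field is bounded on C, so the solution is Lipschitz and has a limit at b, which lies in C.
  -- The system can be solved again from that limit.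
  have hlip : LipschitzOnWith K.toNNReal r (Set.Ico 0 b) := by
    refine (convex_Ico 0 b).lipschitzOnWith_of_nnnorm_hasDerivWithin_le hr fun s hs => ?_
    exact NNReal.coe_le_coe.1 ((hK _ (hrC s hs)).trans (Real.le_coe_toNNReal K))
  obtain ⟨g, hg, hrg⟩ := hlip.extend_pi
  have hgc : Continuous g := hg.continuous
  have hgC : g b ∈ C := by
    have hmem : b ∈ closure (Set.Ico 0 b) := by
      rw [closure_Ico hb.ne]
      exact ⟨hb.le, le_rfl⟩
    have := hgc.continuousOn.image_closure (Set.mem_image_of_mem g hmem)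
    refine closure_minimal ?_ hC.isClosed this
    rintro _ ⟨s, hs, rfl⟩
    exact hrg hs ▸ hrC s hs
  obtain ⟨γ, hγb, ε, hε, hγ⟩ :=
    (hF _ (hCU hgC)).exists_forall_mem_closedBall_exists_eq_forall_mem_Ioo_hasDerivAt₀ b
  have hγc : ContinuousAt γ b := (hγ b ⟨by linarith, by linarith⟩).continuousAt
  have hγU : ∀ᶠ s in 𝓝 b, γ s ∈ U :=
    hγc.eventually (hU.mem_nhds (by rw [hγb]; exact hCU hgC))
  obtain ⟨δ, hδ, hδU⟩ := Metric.eventually_nhds_iff.1 hγU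
  refine ⟨b + min ε δ, by linarith [lt_min hε hδ], fun s => if s < b then r s else γ s,
    fun s hs => by simp [hs.2], fun s hs => ?_⟩
  rcases lt_trichotomy s b with hsb | rfl | hsb
  · have hs' : s ∈ Set.Ico 0 b := ⟨hs.1, hsb⟩
    simp only [if_pos hsb]
    refine ⟨hCU (hrC s hs'), ?_⟩
    have h1 : HasDerivWithinAt r (F (r s)) (Set.Ico 0 (b + min ε δ)) s := by
      refine (hr s hs').mono_of_mem_nhdsWithin ?_
      filter_upwards [self_mem_nhdsWithin, mem_nhdsWithin_of_mem_nhds (Iio_mem_nhds hsb)]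
        with u hu hub using ⟨hu.1, hub⟩
    refine h1.congr_of_eventuallyEq ?_ (by simp [hsb])
    filter_upwards [mem_nhdsWithin_of_mem_nhds (Iio_mem_nhds hsb)] with u hu
    exact if_pos hu
  · simp only [lt_irrefl, if_false]
    rw [hγb]
    refine ⟨hCU hgC, HasDerivAt.hasDerivWithinAt ?_⟩
    have hgd : ∀ u ∈ Set.Ioo 0 s, HasDerivAt g (F (g u)) u := fun u hu => by
      have hu' : u ∈ Set.Ico 0 s := ⟨hu.1.le, hu.2⟩
      have h1 := (hr u hu').hasDerivAt (Ico_mem_nhds hu.1 hu.2)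
      rw [hrg hu'] at h1
      refine h1.congr_of_eventuallyEq ?_
      filter_upwards [Ico_mem_nhds hu.1 hu.2] with v hv
      exact (hrg hv).symm
    -- At the gluing time the left derivative is the limit of the derivatives F (g u), so it matches
    -- the right derivative of γ.
    have hleft : HasDerivWithinAt g (F (g s)) (Set.Iic s) s := by
      refine hasDerivWithinAt_Iic_of_tendsto_deriv (s := Set.Ioo 0 s)
        (fun u hu => (hgd u hu).differentiableAt.differentiableWithinAt)
        hgc.continuousWithinAt (Ioo_mem_nhdsLT hb) ?_
      have h1 : Tendsto (fun u => F (g u)) (𝓝[<] s) (𝓝 (F (g s))) :=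
        (ContinuousAt.comp (f := g) (hF _ (hCU hgC)).continuousAt
          hgc.continuousAt).tendsto.mono_left nhdsWithin_le_nhds
      refine h1.congr' ?_
      filter_upwards [Ioo_mem_nhdsLT hb] with u hu
      exact (hgd u hu).deriv.symm
    have hright : HasDerivAt γ (F (g s)) s := hγb ▸ hγ s ⟨by linarith, by linarith⟩
    have hl : HasDerivWithinAt (fun u => if u < s then r u else γ u) (F (g s)) (Set.Iic s) s := by
      refine hleft.congr_of_eventuallyEq ?_ (by simp [hγb])
      filter_upwards [self_mem_nhdsWithin, mem_nhdsWithin_of_mem_nhds (Ioi_mem_nhds hb)]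
        with u hu hu0
      rcases (show u ≤ s from hu).lt_or_eq with h | rfl
      · rw [if_pos h, hrg ⟨le_of_lt hu0, h⟩]
      · simp [hγb]
    have hr' : HasDerivWithinAt (fun u => if u < s then r u else γ u) (F (g s)) (Set.Ici s) s := by
      refine hright.hasDerivWithinAt.congr (fun u hu => if_neg (not_lt.2 hu)) (by simp)
    have := hl.union hr'
    rwa [Set.Iic_union_Ici, hasDerivWithinAt_univ] at this
  · have hsε : s < b + ε := hs.2.trans_le (by linarith [min_le_left ε δ])
    have hsδ : s < b + δ := hs.2.trans_le (by linarith [min_le_right ε δ])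
    simp only [if_neg hsb.not_gt]
    refine ⟨hδU (by rw [Real.dist_eq, abs_of_pos] <;> linarith), HasDerivAt.hasDerivWithinAt ?_⟩
    refine (hγ s ⟨by linarith, hsε⟩).congr_of_eventuallyEq ?_
    filter_upwards [Ioi_mem_nhds hsb] with u hu
    exact if_neg (not_lt.2 (le_of_lt hu))

section flow

variable {V : Type*} [Fintype V] {M : Type*} [TopologicalSpace M] {T : Triangulation V M} {α : ℝ}

lemma timeInterval_coe (b : ℝ) : timeInterval b = Set.Ico 0 b := by
  ext s
  simp [timeInterval]

lemma timeInterval_top : timeInterval ⊤ = Set.Ici 0 := by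
  ext s
  simp [timeInterval]

lemma isOpen_admissibleSpace : IsOpen (admissibleSpace T) :=
  isOpen_iff_mem_nhds.2 fun _ hr => admissibleSpace_mem_nhds hr

theorem eq_top_of_isMaximalAlphaFlow [Nonempty V] {b : EReal} {r : ℝ → V → ℝ}
    (hr : IsMaximalAlphaFlow T α b r) {C : Set (V → ℝ)} (hC : IsCompact C)
    (hCsub : C ⊆ admissibleSpace T) (hrC : ∀ s ∈ timeInterval b, r s ∈ C) : b = ⊤ := by
  obtain ⟨⟨hb, hflow⟩, hmax⟩ := hr
  induction b with
  | bot => exact absurd hb (by simp)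
  | top => rfl
  | coe b =>
    exfalso
    rw [timeInterval_coe] at hflow hrC
    have hb0 : 0 < b := by exact_mod_cast hb
    obtain ⟨b', hb', r', heq, hr'⟩ := exists_extension_of_mem_compact isOpen_admissibleSpace
      (fun x hx => contDiffAt_flowField α hx) hC hCsub hb0
      (fun s hs => hasDerivWithinAt_pi.2 fun i => (hflow s hs).2 i) hrC
    refine hmax b' r' (by exact_mod_cast hb') ⟨by exact_mod_cast hb0.trans hb', ?_⟩ ?_
    · rw [timeInterval_coe]
      exact fun s hs => ⟨(hr' s hs).1, hasDerivWithinAt_pi.1 (hr' s hs).2⟩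
    · rwa [timeInterval_coe]

end flow

/-! ### The Lyapunov functional and the stationary point. -/

section lyapunov

variable {V : Type*} [Fintype V]

/-- A primitive of the form `∑ rᵢ^α drᵢ / ∑ rᵢ^(α+1)`. -/
lemma exists_log_power_mean [Nonempty V] (α : ℝ) : ∃ g : (V → ℝ) → ℝ,
    (∀ x : V → ℝ, (∀ i, 0 < x i) → ContinuousAt g x) ∧
    ∀ (s : Set ℝ) (τ : ℝ) (r : ℝ → V → ℝ) (r' : V → ℝ), (∀ i, 0 < r τ i) →
      (∀ i, HasDerivWithinAt (fun τ => r τ i) (r' i) s τ) →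
      HasDerivWithinAt (fun τ => g (r τ))
        ((∑ i, r τ i ^ α * r' i) / ∑ i, r τ i ^ (α + 1)) s τ := by
  -- For α = -1 the power mean degenerates to the geometric mean.
  by_cases hα : α + 1 = 0
  · refine ⟨fun x => (∑ i, Real.log (x i)) / Fintype.card V, fun x hx => ?_,
      fun s τ r r' hr hd => ?_⟩
    · have : ∀ i, ContinuousAt (fun x : V → ℝ => Real.log (x i)) x := fun i =>
        (continuous_apply i).continuousAt.log (hx i).ne'
      exact ContinuousAt.div_const (tendsto_finsetSum _ fun i _ => this i) _
    · have h1 := (HasDerivWithinAt.fun_sum (u := Finset.univ)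
        fun i _ => (hd i).log (hr i).ne').div_const (Fintype.card V : ℝ)
      refine h1.congr_deriv ?_
      have hα' : α = -1 := by linarith
      subst hα'
      simp [Real.rpow_neg_one, div_eq_inv_mul]
  · have hL : ∀ x : V → ℝ, (∀ i, 0 < x i) → 0 < ∑ i, x i ^ (α + 1) := fun x hx =>
      Finset.sum_pos (fun i _ => Real.rpow_pos_of_pos (hx i) _) Finset.univ_nonempty
    refine ⟨fun x => Real.log (∑ i, x i ^ (α + 1)) / (α + 1), fun x hx => ?_,
      fun s τ r r' hr hd => ?_⟩
    · have : ∀ i, ContinuousAt (fun x : V → ℝ => x i ^ (α + 1)) x := fun i =>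
        (continuous_apply i).continuousAt.rpow_const (Or.inl (hx i).ne')
      exact (ContinuousAt.log (tendsto_finsetSum _ fun i _ => this i) (hL x hx).ne').div_const _
    · have h1 := ((HasDerivWithinAt.fun_sum (u := Finset.univ)
        fun i _ => (hd i).rpow_const (p := α + 1) (Or.inl (hr i).ne')).log
          (hL _ hr).ne').div_const (α + 1)
      refine h1.congr_deriv ?_
      have : ∑ i, r' i * (α + 1) * r τ i ^ (α + 1 - 1) = (α + 1) * ∑ i, r τ i ^ α * r' i := by
        rw [Finset.mul_sum, add_sub_cancel_right]
        exact Finset.sum_congr rfl fun i _ => by ring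
      rw [this]
      have := (hL _ hr).ne'
      field_simp

variable {M : Type*} [TopologicalSpace M] {T : Triangulation V M} {α : ℝ}

/-- The normalized total curvature decreases along the flow at the rate `|dr/dt|²`. -/
lemma sum_curvature_mul_flowField (x : V → ℝ) :
    ∑ i, curvature T x i * flowField T α x i -
      totalCurvature T x * ((∑ i, x i ^ α * flowField T α x i) / ∑ i, x i ^ (α + 1)) =
    -∑ i, flowField T α x i ^ 2 := by
  have h : totalCurvature T x * ((∑ i, x i ^ α * flowField T α x i) / ∑ i, x i ^ (α + 1)) =
      ∑ i, sAlpha T α x * x i ^ α * flowField T α x i := by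
    simp only [sAlpha, mul_assoc, ← Finset.mul_sum]
    ring
  rw [h, ← Finset.sum_sub_distrib, ← Finset.sum_neg_distrib]
  refine Finset.sum_congr rfl fun i _ => ?_
  rw [flowField]
  ring

/-- A compact set containing a global solution of the `α`-flow contains a stationary point. -/
theorem exists_flowField_eq_zero [Nonempty V] {r : ℝ → V → ℝ} (hr : IsAlphaFlow T α ⊤ r)
    {C : Set (V → ℝ)} (hC : IsCompact C) (hCsub : C ⊆ admissibleSpace T)
    (hrC : ∀ s ∈ timeInterval ⊤, r s ∈ C) : ∃ x ∈ C, flowField T α x = 0 := by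
  by_contra! hne
  obtain ⟨-, hflow⟩ := hr
  rw [timeInterval_top] at hflow hrC
  obtain ⟨g, hgc, hgd⟩ := exists_log_power_mean (V := V) α
  have hg : ContinuousOn g C := fun x hx => (hgc x (hCsub hx).1).continuousWithinAt
  have hF : ∀ i, ContinuousOn (fun x => flowField T α x i) C := fun i =>
    (continuous_apply i).comp_continuousOn fun x hx =>
      (contDiffAt_flowField α (hCsub hx)).continuousAt.continuousWithinAt
  have hS : ContinuousOn (totalCurvature T) C := fun x hx =>
    (contDiffAt_totalCurvature (hCsub hx)).continuousAt.continuousWithinAt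
  have hφ : ContinuousOn (fun x => Real.exp (-g x) * ∑ i, flowField T α x i ^ 2) C :=
    hg.neg.rexp.mul (continuousOn_finsetSum _ fun i _ => (hF i).pow 2)
  -- Without a zero of the field, the minimum over C of the decay rate is a positive δ.
  obtain ⟨x₀, hx₀, hmin⟩ := hC.exists_isMinOn ⟨r 0, hrC 0 Set.self_mem_Ici⟩ hφ
  set δ := Real.exp (-g x₀) * ∑ i, flowField T α x₀ i ^ 2 with hδ
  have hδ0 : 0 < δ := by
    obtain ⟨i, hi⟩ := Function.ne_iff.1 (hne x₀ hx₀)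
    exact mul_pos (Real.exp_pos _) (Finset.sum_pos' (fun i _ => sq_nonneg _)
      ⟨i, Finset.mem_univ _, by simpa [sq_pos_iff] using hi⟩)
  obtain ⟨B, hB⟩ := hC.exists_bound_of_continuousOn (hS.mul hg.neg.rexp)
  have hderiv : ∀ τ ∈ Set.Ici (0 : ℝ), HasDerivWithinAt
      (fun τ => totalCurvature T (r τ) * Real.exp (-g (r τ)) + δ * τ)
      (-(Real.exp (-g (r τ)) * ∑ i, flowField T α (r τ) i ^ 2) + δ) (Set.Ici 0) τ := by
    intro τ hτ
    have h1 := hasDerivWithinAt_totalCurvature (fun τ hτ => (hflow τ hτ).1) hτ (hflow τ hτ).2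
    have h2 := (hgd _ τ r _ (hflow τ hτ).1.1 (hflow τ hτ).2).fun_neg.exp
    refine ((h1.fun_mul h2).fun_add ((hasDerivWithinAt_id τ _).const_mul δ)).congr_deriv ?_
    have h3 := sum_curvature_mul_flowField (T := T) (α := α) (r τ)
    simp only [flowField] at h3 ⊢
    linear_combination Real.exp (-g (r τ)) * h3
  have hanti : AntitoneOn (fun τ => totalCurvature T (r τ) * Real.exp (-g (r τ)) + δ * τ)
      (Set.Ici 0) := by
    refine antitoneOn_of_hasDerivWithinAt_nonpos (convex_Ici 0)
      (fun τ hτ => (hderiv τ hτ).continuousWithinAt)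
      (fun τ hτ => (hderiv τ (interior_subset hτ)).mono interior_subset) fun τ hτ => ?_
    have := hmin (hrC τ (interior_subset hτ))
    simp only [Set.mem_ofPred_eq, ← hδ] at this
    linarith
  have hB0 := abs_le.1 (hB _ (hrC 0 Set.self_mem_Ici))
  have hBpos : 0 ≤ B := (norm_nonneg _).trans (hB _ (hrC 0 Set.self_mem_Ici))
  -- By this time the functional has dropped by at least 2B + 1, but its values lie in [-B, B].
  have ht : (0 : ℝ) ≤ (2 * B + 1) / δ := by positivity
  have hB1 := abs_le.1 (hB _ (hrC _ ht))
  have h := hanti Set.self_mem_Ici ht ht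
  dsimp only at h hB0 hB1
  rw [mul_div_cancel₀ _ hδ0.ne'] at h
  simp only [Pi.mul_apply, Pi.neg_apply] at hB0 hB1
  linarith [hB0.2, hB1.1]

end lyapunov

end AlphaFlow

end

theorem mainTheorem8
    {H : Type*} [TopologicalSpace H] (I : ModelWithCorners ℝ (EuclideanSpace ℝ (Fin 3)) H)
    (M : Type*) [TopologicalSpace M] [T2Space M] [CompactSpace M]
    [ChartedSpace H M] [IsManifold I 0 M]
    (V : Type*) [Fintype V] (T : AlphaFlow.Triangulation V M) (α : ℝ)
    (b : EReal) (r : ℝ → V → ℝ) (hr : AlphaFlow.IsMaximalAlphaFlow T α b r)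
    (C : Set (V → ℝ)) (hC : IsCompact C)
    (hCsub : C ⊆ AlphaFlow.admissibleSpace T ∩ AlphaFlow.unitSphere V)
    (hrC : ∀ s ∈ AlphaFlow.timeInterval b, r s ∈ C) :
    ∃ r₀ : V → ℝ, AlphaFlow.IsSpherePackingMetric T r₀ ∧
      ∃ c : ℝ, ∀ i, AlphaFlow.alphaCurvature T α r₀ i = c := by
  -- On an empty vertex set the squared norm would be 0, so the unit sphere condition provides a
  -- vertex; this makes ∑ rᵢ^(α+1) positive.
  have hV : Nonempty V := by
    by_contra hV
    rw [not_nonempty_iff] at hV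
    have h0 : (0 : ℝ) ∈ AlphaFlow.timeInterval b := ⟨le_rfl, by exact_mod_cast hr.1.1⟩
    have h1 : ∑ i, r 0 i ^ 2 = 1 := (hCsub (hrC 0 h0)).2
    simp at h1
  have hCsub' : C ⊆ AlphaFlow.admissibleSpace T := fun x hx => (hCsub hx).1
  obtain rfl := AlphaFlow.eq_top_of_isMaximalAlphaFlow hr hC hCsub' hrC
  obtain ⟨x, hx, hx0⟩ := AlphaFlow.exists_flowField_eq_zero hr.1 hC hCsub' hrC
  refine ⟨x, AlphaFlow.isSpherePackingMetric_of_mem_admissibleSpace (hCsub' hx),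
    AlphaFlow.sAlpha T α x, fun i => ?_⟩
  have hi : AlphaFlow.sAlpha T α x * x i ^ α - AlphaFlow.curvature T x i = 0 := congrFun hx0 i
  rw [AlphaFlow.alphaCurvature,
    div_eq_iff (Real.rpow_pos_of_pos ((hCsub' hx).1 i) α).ne']
  linarith
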